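/- Let $k$ be a field. An algebraic torus over $k$ is an algebraic group over $k$ isomorphic to $(k^*)^d$ for some integer $d\ge 0$. Let $X$ be an irreducible separated algebraic variety over $k$ (an integral separated $k$-scheme of finite type) with an action of an algebraic torus $T$, where $T$ is embedded in $X$ as a Zariski open subset, such that the action $T\times X\to X$ is a morphism which extends the action of $T$ on itself by multiplication, and such that $X$ has a finite covering by affine $T$-invariant Zariski open subsets. Then there exist a lattice $N$ (a free abelian group of finite rank), with dual lattice $M=\mathrm{Hom}(N,\mathbf Z)$, a fan $\Sigma$ in $N_{\mathbf R}=N\otimes\mathbf R$ and a family $\Gamma=\{\Gamma_\sigma\}_{\sigma\in\Sigma}$ satisfying the conditions below, an isomorphism of algebraic groups $\varphi:T\to T^M=\operatorname{Spec}k[t^M]$ over $k$, and an isomorphism $\psi:X\to T^\Gamma_\Sigma$ of $k$-varieties that is equivariant with respect to $\varphi$, i.e. $\psi(t\cdot x)=\varphi(t)\cdot\psi(x)$, and restricts to $\varphi$ on the open torus $T\subset X$. Here a fan $\Sigma$ is a finite set of strictly convex polyhedral cones in $N_{\mathbf R}$, rational for $N$, that contains every face of each of its cones and in which the intersection of any two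 cones is a face of both. Each $\Gamma_\sigma$ is a finitely generated subsemigroup (containing $0$) of $\check\sigma\cap M$, where $\check\sigma\subset M_{\mathbf R}$ is the dual cone of $\sigma$, and (i) $\mathbf Z\Gamma_\sigma=M$ and $\mathbf R_{\ge0}\Gamma_\sigma=\check\sigma$ for every $\sigma\in\Sigma$; (ii) $\Gamma_\tau=\Gamma_\sigma+M(\tau,\Gamma_\sigma)$ for every $\sigma\in\Sigma$ and every face $\tau$ of $\sigma$, where $M(\tau,\Gamma_\sigma)$ is the sublattice of $M$ spanned by $\Gamma_\sigma\cap\tau^\perp$. The toric variety $T^\Gamma_\Sigma$ is obtained from the affine varieties $T^{\Gamma_\sigma}=\operatorname{Spec}k[t^{\Gamma_\sigma}]$, $\sigma\in\Sigma$, by gluing $T^{\Gamma_\sigma}$ and $T^{\Gamma_{\sigma'}}$ along their common open affine subvariety $T^{\Gamma_{\sigma\cap\sigma'}}$, for all $\sigma,\sigma'\in\Sigma$. The torus $T^M$ acts on it by the action that is given on each chart by $t^\gamma\mapsto t^\gamma\otimes t^\gamma$, and it is embedded in it by the open immersions $T^M\to T^{\Gamma_\sigma}$ dual to the inclusions $\Gamma_\sigma\subset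 M$. -/

import Mathlib

open CategoryTheory AlgebraicGeometry MonoidalCategory Limits TensorProduct
open scoped MonObj

universe u

namespace Toric

section Cones

variable {N : Type} [AddCommGroup N]

/-- The real vector space `N_ℝ = ℝ ⊗ N`. -/
abbrev RealSpace (N : Type) [AddCommGroup N] : Type := ℝ ⊗[ℤ] N

/-- The image of a character `m ∈ M = Hom(N, ℤ)` in `M_ℝ`, the dual space of `N_ℝ`. -/
noncomputable def toReal (m : Module.Dual ℤ N) : Module.Dual ℝ (RealSpace N) :=
  m.baseChange ℝ

theorem toReal_tmul (m : Module.Dual ℤ N) (r : ℝ) (n : N) :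
    toReal m (r ⊗ₜ n) = r * (m n : ℝ) := by
  simp [toReal, mul_comm]

theorem toReal_add (m m' : Module.Dual ℤ N) : toReal (m + m') = toReal m + toReal m' := by
  ext n; simp [toReal]

theorem toReal_zero : toReal (0 : Module.Dual ℤ N) = 0 := by
  ext n; simp [toReal]

theorem toReal_nsmul (n : ℕ) (m : Module.Dual ℤ N) : toReal (n • m) = n • toReal m := by
  ext n; simp [toReal]

theorem toReal_neg (m : Module.Dual ℤ N) : toReal (-m) = -toReal m := by
  ext n; simp [toReal]

/-- The dual cone `σ^∨ ⊆ M_ℝ`. -/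
noncomputable def dualCone (σ : PointedCone ℝ (RealSpace N)) :
    PointedCone ℝ (Module.Dual ℝ (RealSpace N)) :=
  PointedCone.dual (Module.Dual.eval ℝ (RealSpace N)) σ

theorem mem_dualCone {σ : PointedCone ℝ (RealSpace N)} {u : Module.Dual ℝ (RealSpace N)} :
    u ∈ dualCone σ ↔ ∀ v ∈ σ, 0 ≤ u v := by
  simp [dualCone]

/-- `σ` is a polyhedral cone, rational for the lattice `N`: it is generated by finitely many
vectors of `N`. -/
def IsRationalPolyhedral (σ : PointedCone ℝ (RealSpace N)) : Prop :=
  ∃ S : Finset N, σ = PointedCone.hull ℝ ((fun n : N => (1 : ℝ) ⊗ₜ[ℤ] n) '' (S : Set N))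

/-- `τ` is a face of `σ`: it is cut out of `σ` by a supporting hyperplane `u^⊥`, `u ∈ σ^∨`. -/
def IsFace (τ σ : PointedCone ℝ (RealSpace N)) : Prop :=
  ∃ u ∈ dualCone σ, ∀ v, v ∈ τ ↔ v ∈ σ ∧ u v = 0

theorem IsFace.le {τ σ : PointedCone ℝ (RealSpace N)} (h : IsFace τ σ) : τ ≤ σ := by
  obtain ⟨u, -, hu⟩ := h
  exact fun v hv => ((hu v).1 hv).1

/-- The sublattice `M(τ, Γ)` of `M` spanned by `Γ ∩ τ^⊥`. -/
noncomputable def perpLattice (τ : PointedCone ℝ (RealSpace N))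
    (Γ : AddSubmonoid (Module.Dual ℤ N)) : AddSubgroup (Module.Dual ℤ N) :=
  AddSubgroup.closure {m | m ∈ Γ ∧ ∀ v ∈ τ, toReal m v = 0}

end Cones

/-- A fan in `N_ℝ`: a finite set of strictly convex rational polyhedral cones that contains every
face of each of its cones, and in which the intersection of two cones is a face of both. -/
structure Fan (N : Type) [AddCommGroup N] where
  cones : Finset (PointedCone ℝ (RealSpace N))
  polyhedral : ∀ σ ∈ cones, IsRationalPolyhedral σ
  salient : ∀ σ ∈ cones, ∀ v ∈ σ, -v ∈ σ → v = 0
  face_mem : ∀ σ ∈ cones, ∀ τ, IsFace τ σ → τ ∈ cones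
  inter_face : ∀ σ ∈ cones, ∀ σ' ∈ cones, IsFace (σ ⊓ σ') σ ∧ IsFace (σ ⊓ σ') σ'

/-- A triple `(N, Σ, Γ)`: a fan `Σ` in `N_ℝ` and, for every `σ ∈ Σ`, a finitely generated
subsemigroup (with `0`) `Γ_σ` of `M = Hom(N, ℤ)` such that `ℤ Γ_σ = M`, `ℝ≥0 Γ_σ = σ^∨`, and
`Γ_τ = Γ_σ + M(τ, Γ_σ)` for every face `τ` of `σ`. -/
structure ToricData (N : Type) [AddCommGroup N] extends Fan N where
  Γ : {σ // σ ∈ cones} → AddSubmonoid (Module.Dual ℤ N)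
  fg : ∀ σ, (Γ σ).FG
  closure_eq : ∀ σ, AddSubgroup.closure (Γ σ : Set (Module.Dual ℤ N)) = ⊤
  hull_eq : ∀ σ, PointedCone.hull ℝ (toReal '' (Γ σ : Set (Module.Dual ℤ N))) = dualCone σ.1
  compat : ∀ σ τ : {σ // σ ∈ cones}, IsFace τ.1 σ.1 →
    Γ τ = Γ σ ⊔ (perpLattice τ.1 (Γ σ)).toAddSubmonoid

section Lemmas

theorem exists_rat_pos (s : Finset ℝ) (hs : ∀ x ∈ s, 0 < x) :
    ∃ φ : ℝ →ₗ[ℚ] ℚ, ∀ x ∈ s, 0 < φ x := by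
  classical
  let V : Submodule ℚ ℝ := Submodule.span ℚ (s : Set ℝ)
  have : Module.Finite ℚ V := Module.Finite.span_finset ℚ s
  let b := Module.finBasis ℚ V
  have hmem : ∀ x ∈ s, x ∈ V := fun x hx => Submodule.subset_span hx
  let U : Set (Fin (Module.finrank ℚ V) → ℝ) :=
    ⋂ x : s, {q | 0 < ∑ j, ((b.repr ⟨x.1, hmem x x.2⟩ j : ℚ) : ℝ) * q j}
  have hU : IsOpen U := by
    refine isOpen_iInter_of_finite fun x => ?_
    exact isOpen_lt continuous_const (by fun_prop)
  have hne : U.Nonempty := by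
    refine ⟨fun j => (b j : ℝ), Set.mem_iInter.2 fun x => ?_⟩
    have h1 := congrArg V.subtype (b.sum_repr ⟨x.1, hmem x x.2⟩)
    rw [map_sum] at h1
    have h2 : (∑ j, ((b.repr ⟨x.1, hmem x x.2⟩ j : ℚ) : ℝ) * (b j : ℝ)) = x.1 := by
      simpa only [map_smul, Submodule.subtype_apply, Rat.smul_def] using h1
    simpa [h2] using hs x x.2
  have hd : DenseRange (fun q : Fin (Module.finrank ℚ V) → ℚ => fun i => (q i : ℝ)) :=
    DenseRange.piMap fun _ => Rat.denseRange_cast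
  obtain ⟨q, hq⟩ := hd.exists_mem_open hU hne
  obtain ⟨φ, hφ⟩ := LinearMap.exists_extend (b.constr ℚ q)
  refine ⟨φ, fun x hx => ?_⟩
  have h3 : φ x = b.constr ℚ q ⟨x, hmem x hx⟩ := by
    rw [← hφ]; rfl
  have h4 := Set.mem_iInter.1 hq ⟨x, hx⟩
  rw [h3, Module.Basis.constr_apply_fintype]
  have h5 : (0 : ℝ) < ∑ j, ((b.repr ⟨x, hmem x hx⟩ j : ℚ) : ℝ) * (q j : ℝ) := h4
  simp only [Module.Basis.equivFun_apply, smul_eq_mul]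
  exact_mod_cast h5

variable {N : Type} [AddCommGroup N]

/-- A lattice point of the real cone spanned by `Γ` has a positive multiple in `Γ`. -/
theorem exists_nsmul_mem_of_mem_hull (Γ : AddSubmonoid (Module.Dual ℤ N)) (x : Module.Dual ℤ N)
    (hx : toReal x ∈ PointedCone.hull ℝ (toReal '' (Γ : Set (Module.Dual ℤ N)))) :
    ∃ k : ℕ, 0 < k ∧ k • x ∈ Γ := by
  classical
  rw [PointedCone.mem_hull_set] at hx
  obtain ⟨c, hc, hc0, hsum⟩ := hx
  have hc' : ∀ y, y ∈ c.support → ∃ m, m ∈ Γ ∧ toReal m = y := fun y hy => hc hy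
  choose! g hg using hc'
  have hpos : ∀ y ∈ c.support, 0 < c y := fun y hy =>
    lt_of_le_of_ne (hc0 y) (Ne.symm (Finsupp.mem_support_iff.1 hy))
  obtain ⟨φ, hφ⟩ := exists_rat_pos (insert 1 (c.support.image c)) (by
    intro r hr
    rcases Finset.mem_insert.1 hr with rfl | hr
    · exact one_pos
    · obtain ⟨y, hy, rfl⟩ := Finset.mem_image.1 hr
      exact hpos y hy)
  have h1 : 0 < φ 1 := hφ 1 (Finset.mem_insert_self _ _)
  have h2 : ∀ y ∈ c.support, 0 < φ (c y) := fun y hy =>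
    hφ _ (Finset.mem_insert_of_mem (Finset.mem_image_of_mem _ hy))
  -- a common denominator
  let D : ℕ := (φ 1).den * ∏ y ∈ c.support, (φ (c y)).den
  have hD : 0 < D := Nat.mul_pos (φ 1).den_pos (Finset.prod_pos fun y _ => (φ (c y)).den_pos)
  have key : ∀ q : ℚ, 0 < q → q.den ∣ D → ∃ a : ℕ, 0 < a ∧ (a : ℚ) = D * q := by
    rintro q hq ⟨e, he⟩
    have he0 : 0 < e := Nat.pos_of_ne_zero fun h => by simp [h] at he; omega
    refine ⟨e * q.num.toNat, Nat.mul_pos he0 (by simpa using hq), ?_⟩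
    have h3 : ((q.num.toNat : ℤ)) = q.num := Int.toNat_of_nonneg (by simpa using hq.le)
    have h4 : ((q.num.toNat : ℕ) : ℚ) = (q.num : ℚ) := by exact_mod_cast congrArg (Int.cast : ℤ → ℚ) h3
    rw [he]; push_cast; rw [h4, ← Rat.mul_den_eq_num q]; ring
  obtain ⟨k, hk0, hk⟩ := key _ h1 (Dvd.intro _ rfl)
  have : ∀ y ∈ c.support, ∃ a : ℕ, (a : ℚ) = D * φ (c y) := fun y hy => by
    obtain ⟨a, -, ha⟩ := key _ (h2 y hy) (Dvd.dvd.mul_left (Finset.dvd_prod_of_mem (fun y => (φ (c y)).den) hy) _)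
    exact ⟨a, ha⟩
  choose! a ha using this
  refine ⟨k, hk0, ?_⟩
  have : k • x = ∑ y ∈ c.support, a y • g y := by
    refine LinearMap.ext fun n => ?_
    have h5 : (x n : ℝ) = ∑ y ∈ c.support, c y * (g y n : ℝ) := by
      have := congrArg (fun u => u ((1 : ℝ) ⊗ₜ[ℤ] n)) hsum
      simp only [toReal_tmul, one_mul] at this
      rw [← this, Finsupp.sum, LinearMap.sum_apply]
      refine Finset.sum_congr rfl fun y hy => ?_
      rw [LinearMap.smul_apply, ← (hg y hy).2, toReal_tmul, (hg y hy).2, one_mul, smul_eq_mul]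
    have h6 : (x n : ℚ) * φ 1 = ∑ y ∈ c.support, (g y n : ℚ) * φ (c y) := by
      have := congrArg φ h5
      rw [map_sum] at this
      have e : ∀ (z : ℤ) (r : ℝ), φ (r * (z : ℝ)) = (z : ℚ) * φ r := fun z r => by
        have : r * (z : ℝ) = (z : ℚ) • r := by simp [Rat.smul_def, mul_comm]
        rw [this, map_smul, smul_eq_mul]
      simp only [e] at this
      rw [← this, ← e, one_mul]
    have h7 : ((k * x n : ℤ) : ℚ) = ((∑ y ∈ c.support, a y * g y n : ℤ) : ℚ) := by
      push_cast
      rw [hk, mul_assoc, mul_comm (φ 1), h6, Finset.mul_sum]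
      refine Finset.sum_congr rfl fun y hy => ?_
      rw [ha y hy]; ring
    have h8 : (k * x n : ℤ) = ∑ y ∈ c.support, a y * g y n := by exact_mod_cast h7
    simpa [LinearMap.sum_apply] using h8
  rw [this]
  exact sum_mem fun y hy => nsmul_mem (hg y hy).1 _

/-- If `τ` is a face of `σ`, `Γ` is finitely generated and `ℝ≥0 Γ = σ^∨`, there is `m ∈ Γ ∩ τ^⊥`
vanishing on no other points of `σ`, such that `-f ∈ Γ + ℕ (-m)` for `f ∈ Γ ∩ τ^⊥`. -/
theorem exists_exposing {σ τ : PointedCone ℝ (RealSpace N)} (h : IsFace τ σ)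
    (Γ : AddSubmonoid (Module.Dual ℤ N)) (hfg : Γ.FG)
    (hΓ : PointedCone.hull ℝ (toReal '' (Γ : Set (Module.Dual ℤ N))) = dualCone σ) :
    ∃ m ∈ Γ, (∀ v ∈ τ, toReal m v = 0) ∧ (∀ v ∈ σ, toReal m v = 0 → v ∈ τ) ∧
      ∀ f ∈ Γ, (∀ v ∈ τ, toReal f v = 0) → ∃ n : ℕ, n • m - f ∈ Γ := by
  classical
  have hnn : ∀ m ∈ Γ, ∀ v ∈ σ, 0 ≤ toReal m v := fun m hm v hv => by
    have : toReal m ∈ dualCone σ := by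
      rw [← hΓ]; exact Submodule.subset_span ⟨m, hm, rfl⟩
    exact mem_dualCone.1 this v hv
  obtain ⟨S, hS⟩ := hfg
  have hSΓ : ∀ s ∈ S, s ∈ Γ := fun s hs => hS ▸ AddSubmonoid.subset_closure hs
  let S' := S.filter fun s => ∀ v ∈ τ, toReal s v = 0
  let m := ∑ s ∈ S', s
  have hS' : ∀ s ∈ S', s ∈ Γ ∧ ∀ v ∈ τ, toReal s v = 0 := fun s hs =>
    ⟨hSΓ s (Finset.mem_filter.1 hs).1, (Finset.mem_filter.1 hs).2⟩
  have hm : m ∈ Γ := sum_mem fun s hs => (hS' s hs).1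
  have hsum : ∀ (A : Finset (Module.Dual ℤ N)) v, toReal (∑ s ∈ A, s) v = ∑ s ∈ A, toReal s v := by
    intro A v
    induction A using Finset.induction_on with
    | empty => simp [toReal_zero]
    | insert a A ha ih => simp [Finset.sum_insert ha, toReal_add, ih]
  have hmτ : ∀ v ∈ τ, toReal m v = 0 := fun v hv => by
    rw [hsum]; exact Finset.sum_eq_zero fun s hs => (hS' s hs).2 v hv
  -- every element of `Γ ∩ τ^⊥` is dominated by a multiple of `m`
  have hdom : ∀ f ∈ Γ, (∀ v ∈ τ, toReal f v = 0) → ∃ n : ℕ, n • m - f ∈ Γ := by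
    intro f hf
    rw [← hS] at hf
    induction hf using AddSubmonoid.closure_induction with
    | mem s hs =>
      intro hs0
      have hs' : s ∈ S' := Finset.mem_filter.2 ⟨hs, hs0⟩
      refine ⟨1, ?_⟩
      have : 1 • m - s = ∑ s ∈ S'.erase s, s := by
        rw [one_nsmul, sub_eq_iff_eq_add]; exact (Finset.sum_erase_add _ _ hs').symm
      rw [this]
      exact sum_mem fun t ht => (hS' t (Finset.mem_of_mem_erase ht)).1
    | zero => exact fun _ => ⟨0, by simp⟩
    | add x y hx hy ihx ihy =>
      intro h0
      rw [hS] at hx hy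
      have hx0 : ∀ v ∈ τ, toReal x v = 0 ∧ toReal y v = 0 := fun v hv => by
        have h1 := h0 v hv
        have h2 := hnn x hx v (h.le hv)
        have h3 := hnn y hy v (h.le hv)
        rw [toReal_add, LinearMap.add_apply] at h1
        constructor <;> linarith
      obtain ⟨a, ha⟩ := ihx fun v hv => (hx0 v hv).1
      obtain ⟨b, hb⟩ := ihy fun v hv => (hx0 v hv).2
      refine ⟨a + b, ?_⟩
      have : (a + b) • m - (x + y) = (a • m - x) + (b • m - y) := by rw [add_nsmul]; abel
      rw [this]; exact add_mem ha hb
  refine ⟨m, hm, hmτ, ?_, hdom⟩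
  intro v hv hv0
  obtain ⟨u, hu, huτ⟩ := h
  rw [huτ]
  refine ⟨hv, ?_⟩
  rw [← hΓ, PointedCone.mem_hull_set] at hu
  obtain ⟨c, hc, hc0, hcs⟩ := hu
  rw [← hcs, Finsupp.sum, LinearMap.sum_apply]
  refine Finset.sum_eq_zero fun y hy => ?_
  obtain ⟨f, hf, rfl⟩ := hc hy
  have hcy : 0 < c (toReal f) := lt_of_le_of_ne (hc0 _) (Ne.symm (Finsupp.mem_support_iff.1 hy))
  obtain ⟨n, hn⟩ := hdom f hf fun w hw => by
    have hw' := (huτ w).1 hw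
    have h1 : ∑ y ∈ c.support, c y * y w = 0 := by
      have := hw'.2
      rw [← hcs, Finsupp.sum, LinearMap.sum_apply] at this
      simpa using this
    have h2 := (Finset.sum_eq_zero_iff_of_nonneg fun y hy => by
      obtain ⟨f', hf', rfl⟩ := hc hy
      exact mul_nonneg (hc0 _) (hnn f' hf' w hw'.1)).1 h1 _ hy
    exact (mul_eq_zero.1 h2).resolve_left hcy.ne'
  have h3 := hnn _ hn v hv
  have h4 := hnn f hf v hv
  rw [sub_eq_add_neg, toReal_add, toReal_neg, toReal_nsmul] at h3
  simp only [LinearMap.add_apply, LinearMap.neg_apply, LinearMap.smul_apply, hv0, smul_zero] at h3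
  rw [LinearMap.smul_apply, show toReal f v = 0 by linarith, smul_zero]

/-- If `m ∈ Γ` vanishes on no points of `σ` outside `τ`, then every `f ∈ Γ ∩ τ^⊥` is dominated by a
multiple of `m`. -/
theorem exists_nsmul_sub_mem {σ τ : PointedCone ℝ (RealSpace N)} (hσ : IsRationalPolyhedral σ)
    (Γ : AddSubmonoid (Module.Dual ℤ N))
    (hΓ : PointedCone.hull ℝ (toReal '' (Γ : Set (Module.Dual ℤ N))) = dualCone σ)
    (m : Module.Dual ℤ N) (hm : m ∈ Γ) (hmτ : ∀ v ∈ σ, toReal m v = 0 → v ∈ τ)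
    (f : Module.Dual ℤ N) (hf : f ∈ Γ) (hfτ : ∀ v ∈ τ, toReal f v = 0) :
    ∃ n : ℕ, n • m - f ∈ Γ := by
  classical
  have hnn : ∀ m ∈ Γ, ∀ v ∈ σ, 0 ≤ toReal m v := fun m hm v hv => by
    have : toReal m ∈ dualCone σ := by
      rw [← hΓ]; exact Submodule.subset_span ⟨m, hm, rfl⟩
    exact mem_dualCone.1 this v hv
  obtain ⟨S, hS⟩ := hσ
  have hSσ : ∀ s ∈ S, (1 : ℝ) ⊗ₜ[ℤ] s ∈ σ := fun s hs => by
    rw [hS]; exact Submodule.subset_span ⟨s, hs, rfl⟩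
  let n : ℕ := ∑ s ∈ S, (f s).toNat
  have hnσ : toReal (n • m - f) ∈ dualCone σ := by
    rw [mem_dualCone]
    have : ∀ v ∈ PointedCone.hull ℝ ((fun n : N => (1 : ℝ) ⊗ₜ[ℤ] n) '' (S : Set N)),
        0 ≤ toReal (n • m - f) v := by
      intro v hv
      induction hv using Submodule.span_induction with
      | mem x hx =>
        obtain ⟨s, hs, rfl⟩ := hx
        have h1 := hnn m hm _ (hSσ s hs)
        have h2 := hmτ _ (hSσ s hs)
        have h3 := fun h => hfτ _ (h2 h)
        simp only [toReal_tmul, one_mul] at h1 h3 ⊢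
        norm_cast at h1 h3 ⊢
        simp only [LinearMap.sub_apply, LinearMap.smul_apply, nsmul_eq_mul]
        rcases h1.eq_or_lt with h1 | h1
        · simp [h3 h1.symm, ← h1]
        · have h4 : (f s).toNat ≤ n :=
            Finset.single_le_sum (f := fun s => (f s).toNat) (fun _ _ => Nat.zero_le _) hs
          have h5 : f s ≤ (f s).toNat := Int.self_le_toNat _
          have h6 : (n : ℤ) * 1 ≤ n * m s := by gcongr; omega
          have h7 : ((f s).toNat : ℤ) ≤ n := by exact_mod_cast h4
          linarith
      | zero => simp
      | add x y _ _ hx hy => rw [map_add]; exact add_nonneg hx hy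
      | smul a x _ hx =>
        rw [← Nonneg.coe_smul, map_smul]; exact mul_nonneg a.2 hx
    intro v hv
    exact this v (hS ▸ hv)
  rw [← hΓ] at hnσ
  obtain ⟨k, hk, hkΓ⟩ := exists_nsmul_mem_of_mem_hull Γ _ hnσ
  obtain ⟨k, rfl⟩ : ∃ l, k = l + 1 := ⟨k - 1, by omega⟩
  refine ⟨(k + 1) * n, ?_⟩
  have : ((k + 1) * n) • m - f = (k + 1) • (n • m - f) + k • f := by
    rw [mul_nsmul', nsmul_sub, succ_nsmul f k]; abel
  rw [this]
  exact add_mem hkΓ (nsmul_mem hf _)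

end Lemmas


/-- The index type of the cones of the fan, ordered by inclusion. -/
abbrev ToricData.Cone {N : Type} [AddCommGroup N] (D : ToricData N) : Type := {σ // σ ∈ D.cones}

namespace ToricData

variable {N : Type} [AddCommGroup N] (D : ToricData N)

theorem isFace_of_le {τ σ : D.Cone} (h : τ ≤ σ) : IsFace τ.1 σ.1 := by
  have := (D.inter_face τ.1 τ.2 σ.1 σ.2).2
  rwa [inf_eq_left.2 (show τ.1 ≤ σ.1 from h)] at this

theorem Γ_le {τ σ : D.Cone} (h : τ ≤ σ) : D.Γ σ ≤ D.Γ τ := by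
  rw [D.compat σ τ (D.isFace_of_le h)]
  exact le_sup_left

theorem nonneg (σ : D.Cone) (m : Module.Dual ℤ N) (hm : m ∈ D.Γ σ) :
    ∀ v ∈ σ.1, 0 ≤ toReal m v := by
  have : toReal m ∈ dualCone σ.1 := by
    rw [← D.hull_eq]; exact Submodule.subset_span ⟨m, hm, rfl⟩
  exact mem_dualCone.1 this

/-- For a face `τ` of `σ`, the semigroup `Γ_τ` is the localization `Γ_σ + ℕ (-m)` of `Γ_σ` at some
`m ∈ Γ_σ` that cuts out `τ`. -/
theorem exists_localizing {τ σ : D.Cone} (h : τ ≤ σ) :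
    ∃ m ∈ D.Γ σ, -m ∈ D.Γ τ ∧ (∀ v ∈ τ.1, toReal m v = 0) ∧
      (∀ v ∈ σ.1, toReal m v = 0 → v ∈ τ.1) ∧
      ∀ x ∈ D.Γ τ, ∃ n : ℕ, x + n • m ∈ D.Γ σ := by
  have hf := D.isFace_of_le h
  obtain ⟨m, hm, hmτ, hmσ, hdom⟩ := exists_exposing hf (D.Γ σ) (D.fg σ) (D.hull_eq σ)
  have hc := D.compat σ τ hf
  have hmem : ∀ x ∈ D.Γ σ, (∀ v ∈ τ.1, toReal x v = 0) → x ∈ perpLattice τ.1 (D.Γ σ) :=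
    fun x hx h0 => AddSubgroup.subset_closure ⟨hx, h0⟩
  refine ⟨m, hm, ?_, hmτ, hmσ, ?_⟩
  · rw [hc]
    have h1 : -m ∈ (perpLattice τ.1 (D.Γ σ)).toAddSubmonoid :=
      (perpLattice τ.1 (D.Γ σ)).neg_mem (hmem m hm hmτ)
    exact AddSubmonoid.mem_sup_right h1
  · intro x hx
    rw [hc] at hx
    obtain ⟨y, hy, z, hz, rfl⟩ := AddSubmonoid.mem_sup.1 hx
    suffices ∃ n : ℕ, z + n • m ∈ D.Γ σ by
      obtain ⟨n, hn⟩ := this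
      exact ⟨n, by rw [add_assoc]; exact add_mem hy hn⟩
    have hz' : z ∈ perpLattice τ.1 (D.Γ σ) := hz
    clear hz hx
    unfold perpLattice at hz'
    suffices H : (∃ n : ℕ, z + n • m ∈ D.Γ σ) ∧ ∃ n : ℕ, -z + n • m ∈ D.Γ σ from H.1
    induction hz' using AddSubgroup.closure_induction with
    | mem a ha =>
      obtain ⟨n, hn⟩ := hdom a ha.1 ha.2
      exact ⟨⟨0, by simpa using ha.1⟩, n, by rwa [neg_add_eq_sub]⟩
    | zero => exact ⟨⟨0, by simp⟩, 0, by simp⟩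
    | add a b _ _ iha ihb =>
      obtain ⟨⟨n, hn⟩, n', hn'⟩ := iha
      obtain ⟨⟨p, hp⟩, p', hp'⟩ := ihb
      refine ⟨⟨n + p, ?_⟩, n' + p', ?_⟩
      · rw [show a + b + (n + p) • m = (a + n • m) + (b + p • m) by rw [add_nsmul]; abel]
        exact add_mem hn hp
      · rw [show -(a + b) + (n' + p') • m = (-a + n' • m) + (-b + p' • m) by
          rw [add_nsmul]; abel]
        exact add_mem hn' hp'
    | neg a _ iha => exact ⟨iha.2, by simpa using iha.1⟩

end ToricData

noncomputable section Schemes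

variable (k : Type u) [Field k]

/-- The affine scheme `T^Γ = Spec k[t^Γ]` over `k` of a semigroup `Γ`. -/
abbrev affineToric (G : Type) [AddCommMonoid G] : Over (Spec (.of k)) :=
  Over.mk (Spec.map (CommRingCat.ofHom (algebraMap k (AddMonoidAlgebra k G))))

/-- The morphism `T^H ⟶ T^G` over `k` induced by a homomorphism `G → H` of semigroups. -/
def affineToricMap {G H : Type} [AddCommMonoid G] [AddCommMonoid H] (f : G →+ H) :
    affineToric k H ⟶ affineToric k G :=
  Over.homMk (Spec.map (CommRingCat.ofHom
    (AddMonoidAlgebra.mapDomainAlgHom k k f).toRingHom)) (by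
      simp only [Over.mk_hom, ← Spec.map_comp, ← CommRingCat.ofHom_comp]
      congr 2
      exact (AddMonoidAlgebra.mapDomainAlgHom k k f).comp_algebraMap)

/-- The group scheme `T^M = Spec k[t^M]`, with the group law given by `t^m ↦ t^m ⊗ t^m`. -/
abbrev torus (M : Type) [AddCommGroup M] : Over (Spec (.of k)) := affineToric k M

instance (M : Type) [AddCommGroup M] : GrpObj (torus k M) :=
  inferInstanceAs (GrpObj ((Spec (.of (AddMonoidAlgebra k M))).asOver (Spec (.of k))))

/-- The coaction `k[t^Γ] → k[t^M] ⊗ k[t^Γ]`, `t^γ ↦ t^γ ⊗ t^γ`. -/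
def coaction {M : Type} [AddCommGroup M] (Γ : AddSubmonoid M) :
    AddMonoidAlgebra k Γ →ₐ[k] AddMonoidAlgebra k M ⊗[k] AddMonoidAlgebra k Γ :=
  (Algebra.TensorProduct.map (AddMonoidAlgebra.mapDomainAlgHom k k Γ.subtype)
    (AlgHom.id k (AddMonoidAlgebra k Γ))).comp (Bialgebra.comulAlgHom k (AddMonoidAlgebra k Γ))

theorem coaction_single {M : Type} [AddCommGroup M] (Γ : AddSubmonoid M) (g : Γ) :
    coaction k Γ (AddMonoidAlgebra.single g 1) =
      AddMonoidAlgebra.single (g : M) 1 ⊗ₜ AddMonoidAlgebra.single g 1 := by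
  simp [coaction]

/-- The identification `T^M × T^Γ = Spec (k[t^M] ⊗ k[t^Γ])`. -/
def prodIso (M G : Type) [AddCommGroup M] [AddCommMonoid G] :
    (torus k M ⊗ affineToric k G).left ≅
      Spec (.of (AddMonoidAlgebra k M ⊗[k] AddMonoidAlgebra k G)) :=
  pullbackSpecIso k (AddMonoidAlgebra k M) (AddMonoidAlgebra k G)

theorem prodIso_inv_fst (M G : Type) [AddCommGroup M] [AddCommMonoid G] :
    (prodIso k M G).inv ≫ pullback.fst (torus k M).hom (affineToric k G).hom =
      Spec.map (CommRingCat.ofHom Algebra.TensorProduct.includeLeftRingHom) :=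
  pullbackSpecIso_inv_fst ..

theorem prodIso_inv_snd (M G : Type) [AddCommGroup M] [AddCommMonoid G] :
    (prodIso k M G).inv ≫ pullback.snd (torus k M).hom (affineToric k G).hom =
      Spec.map (CommRingCat.ofHom (Algebra.TensorProduct.includeRight :
        AddMonoidAlgebra k G →ₐ[k] AddMonoidAlgebra k M ⊗[k] AddMonoidAlgebra k G).toRingHom) :=
  pullbackSpecIso_inv_snd ..

/-- The action `T^M × T^Γ ⟶ T^Γ`. -/
def affineAction {M : Type} [AddCommGroup M] (Γ : AddSubmonoid M) :
    torus k M ⊗ affineToric k Γ ⟶ affineToric k Γ :=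
  Over.homMk ((prodIso k M Γ).hom ≫ Spec.map (CommRingCat.ofHom (coaction k Γ).toRingHom)) (by
    have h : Spec.map (CommRingCat.ofHom (coaction k Γ).toRingHom) ≫
        Spec.map (CommRingCat.ofHom (algebraMap k (AddMonoidAlgebra k Γ))) =
        Spec.map (CommRingCat.ofHom (algebraMap k
          (AddMonoidAlgebra k M ⊗[k] AddMonoidAlgebra k Γ))) := by
      rw [← Spec.map_comp, ← CommRingCat.ofHom_comp]
      congr 2
      exact (coaction k Γ).comp_algebraMap
    have h' := pullbackSpecIso_hom_base k (AddMonoidAlgebra k M) (AddMonoidAlgebra k Γ)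
    simp only [Over.mk_hom, Category.assoc, h, Over.tensorObj_hom]
    exact h')

theorem affineAction_naturality {M : Type} [AddCommGroup M] {Γ Γ' : AddSubmonoid M} (h : Γ ≤ Γ') :
    torus k M ◁ affineToricMap k (AddSubmonoid.inclusion h) ≫ affineAction k Γ =
      affineAction k Γ' ≫ affineToricMap k (AddSubmonoid.inclusion h) := by
  ext1
  rw [← cancel_epi (prodIso k M Γ').inv]
  have h1 : (prodIso k M Γ').inv ≫ (torus k M ◁ affineToricMap k (AddSubmonoid.inclusion h)).left =
      Spec.map (CommRingCat.ofHom (Algebra.TensorProduct.map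
        (AlgHom.id k (AddMonoidAlgebra k M))
        (AddMonoidAlgebra.mapDomainAlgHom k k (AddSubmonoid.inclusion h))).toRingHom) ≫
      (prodIso k M Γ).inv := by
    apply pullback.hom_ext
    · rw [Category.assoc, Over.whiskerLeft_left_fst, Category.assoc,
        prodIso_inv_fst, prodIso_inv_fst, ← Spec.map_comp, ← CommRingCat.ofHom_comp]
      congr 2
      ext x
      · simp
      · simp
    · rw [Category.assoc, Over.whiskerLeft_left_snd, Category.assoc,
        prodIso_inv_snd, reassoc_of% prodIso_inv_snd]
      simp only [affineToricMap, Over.homMk_left]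
      rw [← Spec.map_comp, ← Spec.map_comp, ← CommRingCat.ofHom_comp, ← CommRingCat.ofHom_comp]
      congr 2
  rw [Over.comp_left, Over.comp_left, reassoc_of% h1]
  simp only [affineAction, affineToricMap, Over.homMk_left, Iso.inv_hom_id_assoc, Category.assoc]
  rw [← Spec.map_comp, ← Spec.map_comp, ← CommRingCat.ofHom_comp, ← CommRingCat.ofHom_comp]
  congr 2
  have : (Algebra.TensorProduct.map (AlgHom.id k (AddMonoidAlgebra k M))
        (AddMonoidAlgebra.mapDomainAlgHom k k (AddSubmonoid.inclusion h))).comp (coaction k Γ) =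
      (coaction k Γ').comp
        (AddMonoidAlgebra.mapDomainAlgHom k k (AddSubmonoid.inclusion h)) := by
    ext x
    simp [coaction_single]
  exact congrArg AlgHom.toRingHom this

theorem isLocalization {M : Type} [AddCommGroup M] {Γ Γ' : AddSubmonoid M} (h : Γ ≤ Γ') (m : M)
    (hm : m ∈ Γ) (hm' : -m ∈ Γ') (hs : ∀ x ∈ Γ', ∃ n : ℕ, x + n • m ∈ Γ) :
    let _ := (AddMonoidAlgebra.mapDomainAlgHom k k (AddSubmonoid.inclusion h)).toRingHom.toAlgebra
    IsLocalization.Away (AddMonoidAlgebra.single ⟨m, hm⟩ 1 : AddMonoidAlgebra k Γ)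
      (AddMonoidAlgebra k Γ') := by
  let _ := (AddMonoidAlgebra.mapDomainAlgHom k k (AddSubmonoid.inclusion h)).toRingHom.toAlgebra
  have hmap : ∀ a : AddMonoidAlgebra k Γ, algebraMap _ (AddMonoidAlgebra k Γ') a =
      AddMonoidAlgebra.mapDomain (AddSubmonoid.inclusion h) a := fun a => rfl
  have hinj : Function.Injective (algebraMap (AddMonoidAlgebra k Γ) (AddMonoidAlgebra k Γ')) :=
    AddMonoidAlgebra.mapDomain_injective (AddSubmonoid.inclusion_injective h)
  apply IsLocalization.Away.mk
  · refine IsUnit.of_mul_eq_one (AddMonoidAlgebra.single ⟨-m, hm'⟩ 1) ?_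
    rw [hmap, AddMonoidAlgebra.mapDomain_single, AddMonoidAlgebra.single_mul_single,
      AddMonoidAlgebra.one_def]
    congr 1
    · ext; simp
    · simp
  · intro s
    induction s using AddMonoidAlgebra.induction_linear with
    | zero => exact ⟨0, 0, by simp⟩
    | add x y hx hy =>
      obtain ⟨n, a, ha⟩ := hx
      obtain ⟨p, b, hb⟩ := hy
      refine ⟨n + p, a * (AddMonoidAlgebra.single ⟨m, hm⟩ 1) ^ p +
        b * (AddMonoidAlgebra.single ⟨m, hm⟩ 1) ^ n, ?_⟩
      rw [map_add, map_mul, map_mul, ← ha, ← hb, map_pow, map_pow]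
      ring
    | single g r =>
      obtain ⟨n, hn⟩ := hs g g.2
      refine ⟨n, AddMonoidAlgebra.single ⟨g + n • m, hn⟩ r, ?_⟩
      rw [hmap, hmap, AddMonoidAlgebra.mapDomain_single, AddMonoidAlgebra.mapDomain_single,
        AddMonoidAlgebra.single_pow, AddMonoidAlgebra.single_mul_single]
      congr 1
      · simp
  · intro a b hab
    exact ⟨0, by rw [hinj hab]⟩

theorem affineToricMap_id (G : Type) [AddCommMonoid G] :
    affineToricMap k (AddMonoidHom.id G) = 𝟙 (affineToric k G) := by
  ext1
  simp only [affineToricMap, Over.homMk_left, AddMonoidAlgebra.mapDomainAlgHom_id, Over.id_left]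
  exact Spec.map_id _

theorem affineToricMap_comp {G H K : Type} [AddCommMonoid G] [AddCommMonoid H] [AddCommMonoid K]
    (f : G →+ H) (g : H →+ K) :
    affineToricMap k (g.comp f) = affineToricMap k g ≫ affineToricMap k f := by
  ext1
  simp only [affineToricMap, Over.homMk_left, Over.comp_left]
  rw [← Spec.map_comp, ← CommRingCat.ofHom_comp]
  congr 2
  rw [AddMonoidAlgebra.mapDomainAlgHom_comp]
  rfl

theorem isOpenImmersion_affineToricMap {M : Type} [AddCommGroup M] {Γ Γ' : AddSubmonoid M}
    (h : Γ ≤ Γ') (m : M)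
    (hm : m ∈ Γ) (hm' : -m ∈ Γ') (hs : ∀ x ∈ Γ', ∃ n : ℕ, x + n • m ∈ Γ) :
    IsOpenImmersion (affineToricMap k (AddSubmonoid.inclusion h)).left := by
  let _ := (AddMonoidAlgebra.mapDomainAlgHom k k (AddSubmonoid.inclusion h)).toRingHom.toAlgebra
  have := isLocalization k h m hm hm' hs
  exact IsOpenImmersion.of_isLocalization (S := AddMonoidAlgebra k Γ')
    (AddMonoidAlgebra.single ⟨m, hm⟩ 1 : AddMonoidAlgebra k Γ)

theorem range_affineToricMap {M : Type} [AddCommGroup M] {Γ Γ' : AddSubmonoid M}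
    (h : Γ ≤ Γ') (m : M)
    (hm : m ∈ Γ) (hm' : -m ∈ Γ') (hs : ∀ x ∈ Γ', ∃ n : ℕ, x + n • m ∈ Γ)
    (x : Spec (.of (AddMonoidAlgebra k Γ))) :
    (∃ y, (affineToricMap k (AddSubmonoid.inclusion h)).left y = x) ↔
      (AddMonoidAlgebra.single ⟨m, hm⟩ 1 : AddMonoidAlgebra k Γ) ∉ x.asIdeal := by
  let _ := (AddMonoidAlgebra.mapDomainAlgHom k k (AddSubmonoid.inclusion h)).toRingHom.toAlgebra
  have := isLocalization k h m hm hm' hs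
  have := PrimeSpectrum.localization_away_comap_range (AddMonoidAlgebra k Γ')
    (AddMonoidAlgebra.single ⟨m, hm⟩ 1 : AddMonoidAlgebra k Γ)
  have h2 := Set.ext_iff.1 this x
  exact h2

end Schemes

noncomputable section Gluing

variable (k : Type u) [Field k] {N : Type} [AddCommGroup N] (D : ToricData N)

namespace ToricData

/-- The affine charts `T^{Γ_σ}` with the open immersions `T^{Γ_τ} ⟶ T^{Γ_σ}` for `τ ≤ σ`. -/
def diagram : D.Cone ⥤ Over (Spec (.of k)) where
  obj σ := affineToric k (D.Γ σ)
  map f := affineToricMap k (AddSubmonoid.inclusion (D.Γ_le (leOfHom f)))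
  map_id σ := affineToricMap_id k _
  map_comp f g := by rw [← affineToricMap_comp]; rfl

/-- The underlying diagram of schemes. -/
abbrev schemeDiagram : D.Cone ⥤ Scheme.{u} := D.diagram k ⋙ Over.forget _

instance isOpenImmersion_map {τ σ : D.Cone} (f : τ ⟶ σ) :
    IsOpenImmersion ((D.schemeDiagram k).map f) := by
  obtain ⟨m, hm, hm', -, -, hs⟩ := D.exists_localizing (leOfHom f)
  exact isOpenImmersion_affineToricMap k (D.Γ_le (leOfHom f)) m hm hm' hs

/-- Inside the chart of `ρ`, the charts of two faces `σ, σ'` intersect in the chart of `σ ∩ σ'`. -/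
theorem exists_common {σ σ' ρ : D.Cone} (f : σ ⟶ ρ) (f' : σ' ⟶ ρ)
    (x : (D.schemeDiagram k).obj σ) (x' : (D.schemeDiagram k).obj σ')
    (h : (D.schemeDiagram k).map f x = (D.schemeDiagram k).map f' x') :
    ∃ (τ : D.Cone) (g : τ ⟶ σ) (g' : τ ⟶ σ') (z : (D.schemeDiagram k).obj τ),
      (D.schemeDiagram k).map g z = x ∧ (D.schemeDiagram k).map g' z = x' := by
  have hτ : σ.1 ⊓ σ'.1 ∈ D.cones :=
    D.face_mem σ.1 σ.2 _ (D.inter_face σ.1 σ.2 σ'.1 σ'.2).1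
  let τ : D.Cone := ⟨σ.1 ⊓ σ'.1, hτ⟩
  let g : τ ⟶ σ := homOfLE (show τ.1 ≤ σ.1 from inf_le_left)
  let g' : τ ⟶ σ' := homOfLE (show τ.1 ≤ σ'.1 from inf_le_right)
  let p : Spec (.of (AddMonoidAlgebra k (D.Γ ρ))) := (D.schemeDiagram k).map f x
  obtain ⟨m, hm, hm', hmσ, hmρ, hs⟩ := D.exists_localizing (leOfHom f)
  obtain ⟨m₁, hm₁, hm₁', hm₁σ, hm₁ρ, hs₁⟩ := D.exists_localizing (leOfHom f')
  obtain ⟨m₂, hm₂, hm₂', hm₂τ, hm₂ρ, hs₂⟩ := D.exists_localizing (leOfHom (g ≫ f))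
  have hp : (AddMonoidAlgebra.single ⟨m, hm⟩ 1 : AddMonoidAlgebra k (D.Γ ρ)) ∉ p.asIdeal :=
    (range_affineToricMap k (D.Γ_le (leOfHom f)) m hm hm' hs p).1 ⟨x, rfl⟩
  have hp₁ : (AddMonoidAlgebra.single ⟨m₁, hm₁⟩ 1 : AddMonoidAlgebra k (D.Γ ρ)) ∉ p.asIdeal :=
    (range_affineToricMap k (D.Γ_le (leOfHom f')) m₁ hm₁ hm₁' hs₁ p).1 ⟨x', h.symm⟩
  have hadd : m + m₁ ∈ D.Γ ρ := add_mem hm hm₁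
  obtain ⟨n, hn⟩ := exists_nsmul_sub_mem (τ := τ.1) (D.polyhedral ρ.1 ρ.2) (D.Γ ρ) (D.hull_eq ρ)
    (m + m₁) hadd (fun v hv h0 => by
      have h1 := D.nonneg ρ m hm v hv
      have h2 := D.nonneg ρ m₁ hm₁ v hv
      rw [toReal_add, LinearMap.add_apply] at h0
      exact ⟨hmρ v hv (by linarith), hm₁ρ v hv (by linarith)⟩) m₂ hm₂ hm₂τ
  have hp₂ : (AddMonoidAlgebra.single ⟨m₂, hm₂⟩ 1 : AddMonoidAlgebra k (D.Γ ρ)) ∉ p.asIdeal := by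
    intro hmem
    have h1 : (AddMonoidAlgebra.single ⟨m₂, hm₂⟩ 1 : AddMonoidAlgebra k (D.Γ ρ)) *
        AddMonoidAlgebra.single ⟨n • (m + m₁) - m₂, hn⟩ 1 =
        (AddMonoidAlgebra.single ⟨m, hm⟩ 1 * AddMonoidAlgebra.single ⟨m₁, hm₁⟩ 1) ^ n := by
      rw [AddMonoidAlgebra.single_mul_single, AddMonoidAlgebra.single_mul_single,
        AddMonoidAlgebra.single_pow]
      congr 1
      · ext1; simp
      · simp
    have h2 : (AddMonoidAlgebra.single ⟨m, hm⟩ 1 * AddMonoidAlgebra.single ⟨m₁, hm₁⟩ 1) ^ n ∈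
        p.asIdeal := h1 ▸ p.asIdeal.mul_mem_right _ hmem
    rcases p.2.mem_or_mem (p.2.mem_of_pow_mem n h2) with h3 | h3
    · exact hp h3
    · exact hp₁ h3
  obtain ⟨z, hz⟩ := (range_affineToricMap k (D.Γ_le (leOfHom (g ≫ f))) m₂ hm₂ hm₂' hs₂ p).2 hp₂
  have hz' : (D.schemeDiagram k).map (g ≫ f) z = (D.schemeDiagram k).map f x := hz
  refine ⟨τ, g, g', z, ?_, ?_⟩
  · apply ((D.schemeDiagram k).map f).isOpenEmbedding.injective
    rw [← hz', Functor.map_comp]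
    rfl
  · apply ((D.schemeDiagram k).map f').isOpenEmbedding.injective
    rw [← h, ← hz', show g ≫ f = g' ≫ f' from Subsingleton.elim _ _, Functor.map_comp]
    rfl

instance : (D.schemeDiagram k ⋙ Scheme.forget).IsLocallyDirected where
  cond {i j l} fi fj xi xj h := by
    obtain ⟨τ, g, g', z, hz, hz'⟩ := D.exists_common k fi fj xi xj h
    exact ⟨τ, g, g', z, hz, hz'⟩

/-- The toric variety `T_Σ^Γ` over `k`: the charts `T^{Γ_σ}`, `σ ∈ Σ`, glued along the common open
subschemes `T^{Γ_{σ ∩ σ'}}`. -/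
def toricVariety : Over (Spec (.of k)) :=
  Over.mk (colimit.desc (D.schemeDiagram k)
    ⟨Spec (.of k), { app σ := ((D.diagram k).obj σ).hom }⟩)

/-- The chart `T^{Γ_σ} ⟶ T_Σ^Γ`. -/
def chart (σ : D.Cone) : affineToric k (D.Γ σ) ⟶ D.toricVariety k :=
  Over.homMk (colimit.ι (D.schemeDiagram k) σ) (colimit.ι_desc _ _)

theorem exists_lift (i j : D.Cone)
    (h : ∀ (l : D.Cone) (g : l ⟶ i) (g' : l ⟶ j),
      (D.schemeDiagram k).map g ≫ colimit.ι (D.schemeDiagram k) i =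
      (D.schemeDiagram k).map g' ≫ colimit.ι (D.schemeDiagram k) j)
    (x : (pullback (colimit.ι (D.schemeDiagram k) i) (colimit.ι (D.schemeDiagram k) j) : Scheme)) :
    ∃ (l : D.Cone) (g : l ⟶ i) (g' : l ⟶ j) (y : (D.schemeDiagram k).obj l),
      pullback.lift ((D.schemeDiagram k).map g) ((D.schemeDiagram k).map g') (h l g g') y = x := by
  let p := pullback.fst (colimit.ι (D.schemeDiagram k) i) (colimit.ι (D.schemeDiagram k) j)
  let q := pullback.snd (colimit.ι (D.schemeDiagram k) i) (colimit.ι (D.schemeDiagram k) j)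
  have h1 : colimit.ι (D.schemeDiagram k) i (p x) = colimit.ι (D.schemeDiagram k) j (q x) := by
    rw [← Scheme.Hom.comp_apply, ← Scheme.Hom.comp_apply, pullback.condition]
  obtain ⟨l, g, g', y, hy, hy'⟩ := (Scheme.IsLocallyDirected.ι_eq_ι_iff _).1 h1
  refine ⟨l, g, g', y, ?_⟩
  apply p.isOpenEmbedding.injective
  rw [← Scheme.Hom.comp_apply, pullback.lift_fst]
  exact hy

/-- The cover of `T_Σ^Γ` by the charts. -/
def cover : (D.toricVariety k).left.OpenCover :=
  Scheme.IsLocallyDirected.openCover (D.schemeDiagram k)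

instance : Category (D.cover k).I₀ := inferInstanceAs (Category D.Cone)

instance : (D.cover k).LocallyDirected where
  trans hij := (D.schemeDiagram k).map hij
  directed x := D.exists_lift k _ _ _ x
  w hij := colimit.w (D.schemeDiagram k) hij
  trans_id σ := (D.schemeDiagram k).map_id σ
  trans_comp f g := (D.schemeDiagram k).map_comp f g
  property_trans hij := D.isOpenImmersion_map k hij

/-- The open immersion `T^{Γ_τ} ⟶ T^{Γ_σ}` for `τ ≤ σ`. -/
def transition {τ σ : D.Cone} (h : τ ≤ σ) : affineToric k (D.Γ τ) ⟶ affineToric k (D.Γ σ) :=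
  affineToricMap k (AddSubmonoid.inclusion (D.Γ_le h))

theorem transition_chart {τ σ : D.Cone} (h : τ ≤ σ) :
    D.transition k h ≫ D.chart k σ = D.chart k τ := by
  ext1
  exact colimit.w (D.schemeDiagram k) (homOfLE h)

/-- The preimage in `T^M × T_Σ^Γ` of a chart, as the product of `T^M` with the chart. -/
def toProd (σ : D.Cone) :
    pullback (pullback.snd (torus k (Module.Dual ℤ N)).hom (D.toricVariety k).hom)
      (D.chart k σ).left ⟶ (torus k (Module.Dual ℤ N) ⊗ affineToric k (D.Γ σ)).left :=
  pullback.lift (f := (torus k (Module.Dual ℤ N)).hom) (g := (affineToric k (D.Γ σ)).hom)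
    (pullback.fst _ _ ≫ pullback.fst _ _) (pullback.snd _ _) (by
      rw [Category.assoc, pullback.condition, pullback.condition_assoc, Over.w])

/-- The restriction of the action to the preimage in `T^M × T_Σ^Γ` of a chart. -/
def actionOnChart (σ : D.Cone) :
    pullback (pullback.snd (torus k (Module.Dual ℤ N)).hom (D.toricVariety k).hom)
      (D.chart k σ).left ⟶ (D.toricVariety k).left :=
  D.toProd k σ ≫ (affineAction k (D.Γ σ) ≫ D.chart k σ).left

theorem toProd_fst (σ : D.Cone) :
    D.toProd k σ ≫ pullback.fst (torus k (Module.Dual ℤ N)).hom (affineToric k (D.Γ σ)).hom =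
      pullback.fst _ _ ≫ pullback.fst _ _ :=
  pullback.lift_fst _ _ _

theorem toProd_snd (σ : D.Cone) :
    D.toProd k σ ≫ pullback.snd (torus k (Module.Dual ℤ N)).hom (affineToric k (D.Γ σ)).hom =
      pullback.snd _ _ :=
  pullback.lift_snd _ _ _

theorem trans_actionOnChart {τ σ : D.Cone} (h : τ ≤ σ) :
    pullback.map (pullback.snd (torus k (Module.Dual ℤ N)).hom (D.toricVariety k).hom)
      (D.chart k τ).left
      (pullback.snd (torus k (Module.Dual ℤ N)).hom (D.toricVariety k).hom)
      (D.chart k σ).left (𝟙 _) (D.transition k h).left (𝟙 _) (by simp) (by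
        rw [← Over.comp_left, transition_chart]; simp) ≫ D.actionOnChart k σ =
      D.actionOnChart k τ := by
  have h1 : pullback.map (pullback.snd (torus k (Module.Dual ℤ N)).hom (D.toricVariety k).hom)
      (D.chart k τ).left
      (pullback.snd (torus k (Module.Dual ℤ N)).hom (D.toricVariety k).hom)
      (D.chart k σ).left (𝟙 _) (D.transition k h).left (𝟙 _) (by simp) (by
        rw [← Over.comp_left, transition_chart]; simp) ≫ D.toProd k σ =
      D.toProd k τ ≫ (torus k (Module.Dual ℤ N) ◁ D.transition k h).left := by
    apply pullback.hom_ext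
    · rw [Category.assoc, Category.assoc, toProd_fst, Over.whiskerLeft_left_fst, toProd_fst,
        pullback.map, pullback.lift_fst_assoc, Category.comp_id]
    · rw [Category.assoc, Category.assoc, toProd_snd, Over.whiskerLeft_left_snd,
        reassoc_of% D.toProd_snd k τ, pullback.map, pullback.lift_snd]
  rw [actionOnChart, reassoc_of% h1, actionOnChart, ← Over.comp_left, ← Category.assoc, transition,
    affineAction_naturality, Category.assoc]
  congr 3
  exact D.transition_chart k h

theorem actionOnChart_hom (σ : D.Cone) :
    D.actionOnChart k σ ≫ (D.toricVariety k).hom =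
      pullback.fst (pullback.snd (torus k (Module.Dual ℤ N)).hom (D.toricVariety k).hom)
        (D.chart k σ).left ≫ (torus k (Module.Dual ℤ N) ⊗ D.toricVariety k).hom := by
  rw [actionOnChart, Category.assoc, Over.w, Over.tensorObj_hom, Over.tensorObj_hom,
    reassoc_of% D.toProd_fst k σ]

/-- The cover of `T^M × T_Σ^Γ` by the preimages of the charts. -/
def actionCover : (torus k (Module.Dual ℤ N) ⊗ D.toricVariety k).left.OpenCover :=
  (D.cover k).pullback₁ (pullback.snd (torus k (Module.Dual ℤ N)).hom (D.toricVariety k).hom)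

instance : Category (D.actionCover k).I₀ := inferInstanceAs (Category D.Cone)

instance : Scheme.Cover.LocallyDirected (D.actionCover k) :=
  inferInstanceAs (Scheme.Cover.LocallyDirected ((D.cover k).pullback₁
    (pullback.snd (torus k (Module.Dual ℤ N)).hom (D.toricVariety k).hom)))

/-- The action of `T^M` on `T_Σ^Γ`, glued from the actions on the charts. -/
def action : torus k (Module.Dual ℤ N) ⊗ D.toricVariety k ⟶ D.toricVariety k :=
  (D.actionCover k).glueMorphismsOverOfLocallyDirected (D.actionOnChart k)
    (fun f => D.trans_actionOnChart k (leOfHom f)) (D.actionOnChart_hom k)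

theorem fst_action (σ : D.Cone) :
    pullback.fst (pullback.snd (torus k (Module.Dual ℤ N)).hom (D.toricVariety k).hom)
      (D.chart k σ).left ≫ (D.action k).left = D.actionOnChart k σ :=
  (D.actionCover k).map_glueMorphismsOverOfLocallyDirected_left (D.actionOnChart k)
    (fun f => D.trans_actionOnChart k (leOfHom f)) (D.actionOnChart_hom k) σ

theorem chart_action (σ : D.Cone) :
    torus k (Module.Dual ℤ N) ◁ D.chart k σ ≫ D.action k =
      affineAction k (D.Γ σ) ≫ D.chart k σ := by
  ext1
  let s : (torus k (Module.Dual ℤ N) ⊗ affineToric k (D.Γ σ)).left ⟶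
      pullback (pullback.snd (torus k (Module.Dual ℤ N)).hom (D.toricVariety k).hom)
        (D.chart k σ).left :=
    pullback.lift (torus k (Module.Dual ℤ N) ◁ D.chart k σ).left
      (pullback.snd (torus k (Module.Dual ℤ N)).hom (affineToric k (D.Γ σ)).hom)
      (Over.whiskerLeft_left_snd _)
  have h1 : s ≫ pullback.fst _ _ = (torus k (Module.Dual ℤ N) ◁ D.chart k σ).left :=
    pullback.lift_fst _ _ _
  have h2 : s ≫ D.toProd k σ = 𝟙 _ := by
    apply pullback.hom_ext
    · rw [Category.assoc, toProd_fst, reassoc_of% h1, Over.whiskerLeft_left_fst, Category.id_comp]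
    · rw [Category.assoc, toProd_snd, Category.id_comp]
      exact pullback.lift_snd _ _ _
  rw [Over.comp_left, ← h1, Category.assoc, fst_action, actionOnChart, reassoc_of% h2]

end ToricData

end Gluing

section Varieties

variable {k : Type u} [Field k]

/-- `T` is an algebraic torus over `k`: a group scheme isomorphic to `Spec k[ℤ^d] = (k^*)^d` for
some `d`. -/
def IsAlgebraicTorus (T : Over (Spec (.of k))) [GrpObj T] : Prop :=
  ∃ (d : ℕ) (e : T ≅ torus k (Fin d → ℤ)), IsMonHom e.hom

/-- The open subset `U` of `X` is invariant under the action of `T`: the action `T × X ⟶ X` maps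
`T × U` into `U`. -/
def IsInvariantOpen (T X : Over (Spec (.of k))) [GrpObj T] [ModObj T X]
    (U : X.left.Opens) : Prop :=
  (pullback.snd T.hom X.hom : (T ⊗ X).left ⟶ X.left) ⁻¹ᵁ U ≤ (γ[T, X] : T ⊗ X ⟶ X).left ⁻¹ᵁ U

/-- `X` is a toric variety over `k` with torus `T`, embedded in `X` by `j`: an irreducible separated
algebraic variety with an action of the algebraic torus `T`, embedded as an open subset of `X`, which
extends the action of `T` on itself by multiplication, and a finite covering of `X` by affine
`T`-invariant open subsets. -/
structure IsToricVariety (T X : Over (Spec (.of k))) [GrpObj T] [ModObj T X] (j : T ⟶ X) :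
    Prop where
  isAlgebraicTorus : IsAlgebraicTorus T
  isIntegral : IsIntegral X.left
  isSeparated : IsSeparated X.hom
  locallyOfFiniteType : LocallyOfFiniteType X.hom
  quasiCompact : QuasiCompact X.hom
  isOpenImmersion : IsOpenImmersion j.left
  extends_mul : T ◁ j ≫ (γ[T, X] : T ⊗ X ⟶ X) = μ[T] ≫ j
  exists_cover : ∃ 𝒰 : Set X.left.Opens, 𝒰.Finite ∧
    (∀ U ∈ 𝒰, IsAffineOpen U ∧ IsInvariantOpen T X U) ∧ sSup 𝒰 = ⊤

end Varieties

end Toric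

/-! The plan is to turn each invariant affine open set into a semigroup of characters, and geometry
between these open sets into algebra between the semigroups.

A nonempty invariant open `U` meets the dense torus, hence contains it. If `U = Spec A` is affine,
then `A` embeds in `k[M]` and is stable under the coaction `t^m ↦ t^m ⊗ t^m`; a stable subalgebra
contains the homogeneous components of its elements, so it is spanned by characters and `A = k[Γ]`
(`exists_algEquiv_of_comodule`).

For two such charts, separatedness makes `U ∩ U'` closed in `U × U'`. It is integral and the torus
is dense in it; the same holds for `T^{Γ + Γ'}`, embedded by the surjection `k[Γ] ⊗ k[Γ'] → k[Γ +
Γ']`. So both are the closure of the torus and coincide (`IsChart.sup`). An open immersion `T^{Γ'} →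
T^Γ` over the torus can only be a localization `Γ' = Γ + ℕ(-m)` with `m ∈ Γ`
(`isLoc_of_isOpenImmersion`). Hence `Γ + Γ'` is a localization of both `Γ` and `Γ'`.

The fan is then read off from the finite family of all localizations of the chart semigroups: its
cones are the `coneOf Γ`. Convex duality (`dualCone_coneOf`, `isRationalPolyhedral_coneOf`) makes
localizations of `Γ` correspond to faces of its cone. The semigroups need not be saturated, so a
cone alone does not determine its semigroup; within the family it does, because sums are
localizations (`IsFanFamily.eq_of_coneOf_eq`).

Finally `X` and the toric variety are glued from the same charts in the same way. Equivariance needs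
to be checked only on the dense torus, since `X` is separated. -/

namespace Toric

/-! ### Convex duality for rational cones. -/

section Farkas

/-- One half of the Minkowski-Weyl theorem with integrality: the cone generated by finitely many
vectors `i g` is cut out by finitely many of the functionals `β s`. -/
theorem exists_finset_dual_hull {A B V : Type*} [AddCommGroup A] [AddCommGroup B] [AddCommGroup V]
    [Module ℝ V] (i : A → V) (β : B →+ Module.Dual ℝ V) (p : A → B → ℤ)
    (hp : ∀ a b, β b (i a) = p a b) (S₀ : Finset B)
    (hS₀ : ∀ v, (∀ s ∈ S₀, 0 ≤ β s v) → v = 0) (G : Finset A) :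
    ∃ S : Finset B, (∀ s ∈ S, ∀ g ∈ G, 0 ≤ β s (i g)) ∧
      ∀ v, (∀ s ∈ S, 0 ≤ β s v) → v ∈ PointedCone.hull ℝ (i '' (G : Set A)) := by
  classical
  induction G using Finset.induction_on with
  | empty => exact ⟨S₀, by simp, fun v hv => by rw [hS₀ v hv]; exact zero_mem _⟩
  | insert g G hg ih =>
    obtain ⟨S, hSG, hS⟩ := ih
    -- Dual Fourier–Motzkin step: keep the inequalities that `g` satisfies, and replace the violated
    -- ones by positive combinations of a violated and a strictly satisfied one that vanish at `g`.
    -- The coefficients `p` are integers, so the combinations stay in `B`.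
    refine ⟨S.filter (fun s => 0 ≤ p g s) ∪
      ((S.filter fun s => 0 < p g s) ×ˢ (S.filter fun s => p g s < 0)).image
        (fun s => p g s.1 • s.2 - p g s.2 • s.1), ?_, ?_⟩
    · intro s hs h hh
      rcases Finset.mem_union.1 hs with hs | hs
      · rw [Finset.mem_filter] at hs
        rcases Finset.mem_insert.1 hh with rfl | hh
        · rw [hp]; exact_mod_cast hs.2
        · exact hSG s hs.1 h hh
      · obtain ⟨⟨s, t⟩, hst, rfl⟩ := Finset.mem_image.1 hs
        simp only [Finset.mem_product, Finset.mem_filter] at hst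
        obtain ⟨⟨hs, hs0⟩, ht, ht0⟩ := hst
        simp only [map_sub, map_zsmul, LinearMap.sub_apply, LinearMap.smul_apply, zsmul_eq_mul]
        rcases Finset.mem_insert.1 hh with rfl | hh
        · rw [hp, hp, mul_comm, sub_self]
        · have h1 := hSG s hs h hh
          have h2 := hSG t ht h hh
          have h3 : (0 : ℝ) < p g s := by exact_mod_cast hs0
          have h4 : (p g t : ℝ) < 0 := by exact_mod_cast ht0
          nlinarith
    · intro v hv
      have hv1 : ∀ s ∈ S, 0 ≤ p g s → 0 ≤ β s v := fun s hs h =>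
        hv s (Finset.mem_union_left _ (Finset.mem_filter.2 ⟨hs, h⟩))
      have hv2 : ∀ s ∈ S, 0 < p g s → ∀ t ∈ S, p g t < 0 →
          0 ≤ (p g s : ℝ) * β t v - p g t * β s v := fun s hs h t ht h' => by
        have := hv (p g s • t - p g t • s) (Finset.mem_union_right _ (Finset.mem_image.2
          ⟨(s, t), by simp [hs, h, ht, h'], rfl⟩))
        simpa only [map_sub, map_zsmul, LinearMap.sub_apply, LinearMap.smul_apply,
          zsmul_eq_mul] using this
      -- It suffices to subtract a multiple `c` of `g` from `v` so that all old inequalities hold.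
      -- Those negative at `g` bound `c` from below, those positive at `g` from above; the combined
      -- inequalities say that every lower bound is at most every upper bound. The greatest lower
      -- bound, or `0`, is taken for `c`.
      obtain ⟨c, hc0, hc⟩ : ∃ c : ℝ, 0 ≤ c ∧ ∀ s ∈ S, 0 ≤ β s v - c * p g s := by
        let Tn := insert 0 ((S.filter fun s => p g s < 0).image fun s => β s v / p g s)
        have hTn : Tn.Nonempty := Finset.insert_nonempty _ _
        refine ⟨Tn.max' hTn, Finset.le_max' _ _ (Finset.mem_insert_self _ _), fun s hs => ?_⟩
        rcases lt_trichotomy (p g s) 0 with h | h | h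
        · have h1 : β s v / p g s ≤ Tn.max' hTn :=
            Finset.le_max' Tn _ (Finset.mem_insert_of_mem (Finset.mem_image_of_mem
              (fun s => β s v / p g s) (Finset.mem_filter.2 ⟨hs, h⟩)))
          have h2 : (p g s : ℝ) < 0 := by exact_mod_cast h
          rw [div_le_iff_of_neg h2] at h1
          linarith
        · have := hv1 s hs h.ge
          simpa [h] using this
        · have h2 : (0 : ℝ) < p g s := by exact_mod_cast h
          suffices Tn.max' hTn ≤ β s v / p g s by
            rw [le_div_iff₀ h2] at this; linarith
          refine Finset.max'_le _ _ _ fun y hy => ?_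
          rcases Finset.mem_insert.1 hy with rfl | hy
          · exact div_nonneg (hv1 s hs h.le) h2.le
          · obtain ⟨t, ht, rfl⟩ := Finset.mem_image.1 hy
            rw [Finset.mem_filter] at ht
            have h3 : (p g t : ℝ) < 0 := by exact_mod_cast ht.2
            have h4 := hv2 s hs h t ht.1 ht.2
            rw [div_le_iff_of_neg h3, div_mul_eq_mul_div, div_le_iff₀ h2]
            linarith
      have h1 : v - c • i g ∈ PointedCone.hull ℝ (i '' (G : Set A)) := by
        refine hS _ fun s hs => ?_
        rw [map_sub, map_smul, hp, smul_eq_mul]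
        exact hc s hs
      have h2 : PointedCone.hull ℝ (i '' (G : Set A)) ≤
          PointedCone.hull ℝ (i '' ((insert g G : Finset A) : Set A)) :=
        Submodule.span_mono (Set.image_mono (by simp))
      have h3 : i g ∈ PointedCone.hull ℝ (i '' ((insert g G : Finset A) : Set A)) :=
        Submodule.subset_span ⟨g, by simp, rfl⟩
      have h4 := Submodule.smul_mem _ (⟨c, hc0⟩ : {c : ℝ // 0 ≤ c}) h3
      have := add_mem (h2 h1) h4
      rwa [show v - c • i g + (⟨c, hc0⟩ : {c : ℝ // 0 ≤ c}) • i g = v by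
        rw [Nonneg.mk_smul, sub_add_cancel]] at this

variable {N : Type} [AddCommGroup N]

/-- The map `m ↦ toReal m` as a homomorphism of groups. -/
noncomputable def toRealHom : Module.Dual ℤ N →+ Module.Dual ℝ (RealSpace N) where
  toFun := toReal
  map_zero' := toReal_zero
  map_add' := toReal_add

/-- Evaluation at the lattice points of `N_ℝ`. -/
noncomputable def evalHom : N →+ Module.Dual ℝ (Module.Dual ℝ (RealSpace N)) where
  toFun n := Module.Dual.eval ℝ (RealSpace N) (1 ⊗ₜ n)
  map_zero' := by simp
  map_add' a b := by rw [tmul_add, map_add]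

theorem hull_le_of_forall {V : Type*} [AddCommGroup V] [Module ℝ V] {s : Set V}
    {f : Module.Dual ℝ V} (h : ∀ v ∈ s, 0 ≤ f v) {v : V} (hv : v ∈ PointedCone.hull ℝ s) :
    0 ≤ f v := by
  induction hv using Submodule.span_induction with
  | mem x hx => exact h x hx
  | zero => simp
  | add x y _ _ hx hy => rw [map_add]; exact add_nonneg hx hy
  | smul a x _ hx => rw [← Nonneg.coe_smul, map_smul]; exact mul_nonneg a.2 hx

/-- The cone in `N_ℝ` of the vectors at which `Γ` is nonnegative. -/
noncomputable def coneOf (Γ : AddSubmonoid (Module.Dual ℤ N)) : PointedCone ℝ (RealSpace N) :=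
  PointedCone.dual (LinearMap.id) (toReal '' (Γ : Set (Module.Dual ℤ N)))

theorem mem_coneOf {Γ : AddSubmonoid (Module.Dual ℤ N)} {v : RealSpace N} :
    v ∈ coneOf Γ ↔ ∀ m ∈ Γ, 0 ≤ toReal m v := by
  simp [coneOf]

theorem toReal_nonneg_of_closure {S : Set (Module.Dual ℤ N)} {v : RealSpace N}
    (h : ∀ m ∈ S, 0 ≤ toReal m v) {m : Module.Dual ℤ N} (hm : m ∈ AddSubmonoid.closure S) :
    0 ≤ toReal m v := by
  induction hm using AddSubmonoid.closure_induction with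
  | mem x hx => exact h x hx
  | zero => simp [toReal_zero]
  | add x y _ _ hx hy => rw [toReal_add]; exact add_nonneg hx hy

variable [Module.Free ℤ N] [Module.Finite ℤ N]

/-- The coordinate functions of a basis and their negatives will do. Such a set starts the induction
in `exists_finset_dual_hull`, where the empty set generates the zero cone. -/
theorem exists_dual_separating : ∃ S₀ : Finset (Module.Dual ℤ N),
    ∀ v : RealSpace N, (∀ s ∈ S₀, 0 ≤ toReal s v) → v = 0 := by
  classical
  let b := Module.Free.chooseBasis ℤ N
  refine ⟨Finset.univ.image b.coord ∪ Finset.univ.image (fun i => -b.coord i), fun v hv => ?_⟩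
  have h : ∀ i, toReal (b.coord i) v = 0 := fun i => by
    have h1 := hv (b.coord i) (by simp)
    have h2 := hv (-b.coord i) (by simp)
    rw [toReal_neg, LinearMap.neg_apply] at h2
    linarith
  apply (b.baseChange ℝ).repr.injective
  ext i
  rw [map_zero, Finsupp.zero_apply, ← h i]
  have : (b.baseChange ℝ).coord i = toReal (b.coord i) := by
    apply (b.baseChange ℝ).ext
    intro j
    simp [toReal_tmul, Finsupp.single_apply]
  exact congrArg (· v) this

theorem exists_separating : ∃ S₀ : Finset N,
    ∀ u : Module.Dual ℝ (RealSpace N), (∀ s ∈ S₀, 0 ≤ u (1 ⊗ₜ s)) → u = 0 := by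
  classical
  let b := Module.Free.chooseBasis ℤ N
  refine ⟨Finset.univ.image b ∪ Finset.univ.image (fun i => -b i), fun u hu => ?_⟩
  apply (b.baseChange ℝ).ext
  intro i
  have h1 := hu (b i) (by simp)
  have h2 := hu (-b i) (by simp)
  rw [tmul_neg, map_neg] at h2
  simp only [Module.Basis.baseChange_apply, LinearMap.zero_apply]
  linarith

/-- The cone generated by `Γ` in `M_ℝ` is cut out by finitely many `n ∈ N`. These lie in `coneOf Γ`,
so a functional that is nonnegative there satisfies the inequalities and belongs to the cone of `Γ`.
-/
theorem dualCone_coneOf {Γ : AddSubmonoid (Module.Dual ℤ N)} (hΓ : Γ.FG) :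
    dualCone (coneOf Γ) = PointedCone.hull ℝ (toReal '' (Γ : Set (Module.Dual ℤ N))) := by
  obtain ⟨S, rfl⟩ := hΓ
  obtain ⟨S₀, hS₀⟩ := exists_separating (N := N)
  obtain ⟨G, hG, hGS⟩ := exists_finset_dual_hull (toReal (N := N)) (evalHom (N := N))
    (fun m n => m n) (fun m n => by simp [evalHom, toReal_tmul]) S₀ hS₀ S
  apply le_antisymm
  · intro u hu
    refine Submodule.span_mono (Set.image_mono AddSubmonoid.subset_closure) (hGS u fun n hn => ?_)
    refine mem_dualCone.1 hu _ (mem_coneOf.2 fun m hm => toReal_nonneg_of_closure ?_ hm)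
    exact fun m hm => hG n hn m hm
  · refine Submodule.span_le.2 ?_
    rintro _ ⟨m, hm, rfl⟩
    exact mem_dualCone.2 fun v hv => mem_coneOf.1 hv m hm

/-- The lattice vectors `G` that cut out the cone of `Γ` in `M_ℝ` generate `coneOf Γ`: a second
application of Farkas cuts out the hull of `G` by characters, which lie in the cone of `Γ` and are
therefore nonnegative on `coneOf Γ`. -/
theorem isRationalPolyhedral_coneOf {Γ : AddSubmonoid (Module.Dual ℤ N)} (hΓ : Γ.FG) :
    IsRationalPolyhedral (coneOf Γ) := by
  obtain ⟨S, rfl⟩ := hΓ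
  obtain ⟨S₀, hS₀⟩ := exists_separating (N := N)
  obtain ⟨G, hG, hGS⟩ := exists_finset_dual_hull (toReal (N := N)) (evalHom (N := N))
    (fun m n => m n) (fun m n => by simp [evalHom, toReal_tmul]) S₀ hS₀ S
  obtain ⟨T₀, hT₀⟩ := exists_dual_separating (N := N)
  obtain ⟨T, hT, hTG⟩ := exists_finset_dual_hull (fun n : N => (1 : ℝ) ⊗ₜ[ℤ] n)
    (toRealHom (N := N)) (fun n m => m n) (fun m n => by simp [toRealHom, toReal_tmul]) T₀ hT₀ G
  refine ⟨G, le_antisymm (fun v hv => hTG v fun t ht => ?_) ?_⟩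
  · have h1 := hGS (toReal t) fun n hn => hT t ht n hn
    refine hull_le_of_forall (f := Module.Dual.eval ℝ (RealSpace N) v) ?_ h1
    rintro _ ⟨s, hs, rfl⟩
    exact mem_coneOf.1 hv s (AddSubmonoid.subset_closure hs)
  · refine Submodule.span_le.2 ?_
    rintro _ ⟨n, hn, rfl⟩
    exact mem_coneOf.2 fun m hm => toReal_nonneg_of_closure (fun m hm => hG n hn m hm) hm

end Farkas

/-! ### Localizations of semigroups. -/

section Localization

variable {M : Type*} [AddCommGroup M]

/-- `Γ'` is the localization `Γ + ℕ (-m)` of `Γ` at some `m ∈ Γ`. -/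
def IsLoc (Γ Γ' : AddSubmonoid M) : Prop :=
  Γ ≤ Γ' ∧ ∃ m ∈ Γ, -m ∈ Γ' ∧ ∀ x ∈ Γ', ∃ n : ℕ, x + n • m ∈ Γ

theorem IsLoc.le {Γ Γ' : AddSubmonoid M} (h : IsLoc Γ Γ') : Γ ≤ Γ' := h.1

theorem IsLoc.refl (Γ : AddSubmonoid M) : IsLoc Γ Γ :=
  ⟨le_rfl, 0, zero_mem _, by simp, fun x hx => ⟨0, by simpa⟩⟩

theorem IsLoc.trans {Γ Γ' Γ'' : AddSubmonoid M} (h : IsLoc Γ Γ') (h' : IsLoc Γ' Γ'') :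
    IsLoc Γ Γ'' := by
  obtain ⟨h1, m, hm, hm', hs⟩ := h
  obtain ⟨h1', m', hm1, hm1', hs'⟩ := h'
  obtain ⟨a, ha⟩ := hs m' hm1
  refine ⟨h1.trans h1', m' + a • m + m, add_mem ha hm, ?_, fun x hx => ?_⟩
  · rw [show -(m' + a • m + m) = -m' + (a + 1) • -m by rw [succ_nsmul, smul_neg]; abel]
    exact add_mem hm1' (nsmul_mem (h1' hm') _)
  · obtain ⟨b, hb⟩ := hs' x hx
    obtain ⟨c, hc⟩ := hs _ hb
    refine ⟨b + c, ?_⟩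
    rw [show x + (b + c) • (m' + a • m + m) =
      (x + b • m' + c • m) + (b • (a • m + m) + c • (m' + a • m)) by
        simp only [add_nsmul, nsmul_add]; abel]
    exact add_mem hc (add_mem (nsmul_mem (add_mem (nsmul_mem hm _) hm) _) (nsmul_mem ha _))

theorem IsLoc.sup {Γ Γ' : AddSubmonoid M} (h : IsLoc Γ Γ') (H : AddSubmonoid M) :
    IsLoc (Γ ⊔ H) (Γ' ⊔ H) := by
  obtain ⟨h1, m, hm, hm', hs⟩ := h
  refine ⟨sup_le_sup_right h1 H, m, AddSubmonoid.mem_sup_left hm, AddSubmonoid.mem_sup_left hm',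
    fun x hx => ?_⟩
  obtain ⟨y, hy, z, hz, rfl⟩ := AddSubmonoid.mem_sup.1 hx
  obtain ⟨n, hn⟩ := hs y hy
  exact ⟨n, AddSubmonoid.mem_sup.2 ⟨_, hn, z, hz, by abel⟩⟩

theorem IsLoc.eq_sup {Γ Γ' : AddSubmonoid M} (h : IsLoc Γ Γ') :
    ∃ m ∈ Γ, Γ' = Γ ⊔ AddSubmonoid.closure {-m} := by
  obtain ⟨h1, m, hm, hm', hs⟩ := h
  refine ⟨m, hm, le_antisymm (fun x hx => ?_) (sup_le h1 ?_)⟩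
  · obtain ⟨n, hn⟩ := hs x hx
    refine AddSubmonoid.mem_sup.2 ⟨_, hn, n • -m,
      nsmul_mem (AddSubmonoid.subset_closure (Set.mem_singleton _)) n, ?_⟩
    rw [smul_neg]; abel
  · rw [AddSubmonoid.closure_le]; simpa using hm'

theorem IsLoc.fg {Γ Γ' : AddSubmonoid M} (h : IsLoc Γ Γ') (hΓ : Γ.FG) : Γ'.FG := by
  obtain ⟨m, -, rfl⟩ := h.eq_sup
  exact hΓ.sup ⟨{-m}, by simp⟩

theorem isLoc_sup_closure {Γ : AddSubmonoid M} {m : M} (hm : m ∈ Γ) :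
    IsLoc Γ (Γ ⊔ AddSubmonoid.closure {-m}) := by
  refine ⟨le_sup_left, m, hm,
    AddSubmonoid.mem_sup_right (AddSubmonoid.subset_closure (Set.mem_singleton _)),
    fun x hx => ?_⟩
  obtain ⟨y, hy, z, hz, rfl⟩ := AddSubmonoid.mem_sup.1 hx
  obtain ⟨n, rfl⟩ := AddSubmonoid.mem_closure_singleton.1 hz
  refine ⟨n, ?_⟩
  rwa [smul_neg, neg_add_cancel_right]

theorem IsLoc.closure_eq_top {Γ Γ' : AddSubmonoid M} (h : IsLoc Γ Γ')
    (hΓ : AddSubgroup.closure (Γ : Set M) = ⊤) : AddSubgroup.closure (Γ' : Set M) = ⊤ :=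
  top_le_iff.1 (hΓ ▸ AddSubgroup.closure_mono h.le)

theorem closure_eq_top_of_isLoc_top {Γ : AddSubmonoid M} (h : IsLoc Γ ⊤) :
    AddSubgroup.closure (Γ : Set M) = ⊤ := by
  obtain ⟨-, m, hm, -, hs⟩ := h
  refine top_le_iff.1 fun x _ => ?_
  obtain ⟨n, hn⟩ := hs x trivial
  rw [show x = x + n • m - n • m by abel]
  exact sub_mem (AddSubgroup.subset_closure hn) (nsmul_mem (AddSubgroup.subset_closure hm) _)

/-- A localization is determined by the generators of `Γ` that become invertible in it: a sum of
elements of `Γ` is invertible there exactly when every summand is, so these generators decide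
whether the localizing element `m` is. -/
theorem finite_setOf_isLoc {Γ : AddSubmonoid M} (hΓ : Γ.FG) : {Γ' | IsLoc Γ Γ'}.Finite := by
  classical
  obtain ⟨S, hS⟩ := hΓ
  have key : ∀ Γ₁ Γ₂ : AddSubmonoid M, IsLoc Γ Γ₁ → IsLoc Γ Γ₂ →
      (S.filter fun s => -s ∈ Γ₁) = (S.filter fun s => -s ∈ Γ₂) → Γ₁ ≤ Γ₂ := by
    intro Γ₁ Γ₂ h1 h2 h
    have hneg : ∀ x ∈ AddSubmonoid.closure (S : Set M), -x ∈ Γ₁ → -x ∈ Γ₂ := by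
      intro x hx
      induction hx using AddSubmonoid.closure_induction with
      | mem s hs =>
        intro hs1
        have : s ∈ S.filter fun s => -s ∈ Γ₂ := h ▸ Finset.mem_filter.2 ⟨hs, hs1⟩
        exact (Finset.mem_filter.1 this).2
      | zero => exact fun _ => by simp
      | add x y hx hy ihx ihy =>
        intro hxy
        rw [hS] at hx hy
        rw [neg_add]
        refine add_mem (ihx ?_) (ihy ?_)
        · rw [show -x = -(x + y) + y by abel]; exact add_mem hxy (h1.le hy)
        · rw [show -y = -(x + y) + x by abel]; exact add_mem hxy (h1.le hx)
    obtain ⟨h1', m, hm, hm', hs⟩ := h1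
    intro x hx
    obtain ⟨n, hn⟩ := hs x hx
    rw [show x = x + n • m + n • -m by rw [smul_neg]; abel]
    exact add_mem (h2.le hn) (nsmul_mem (hneg m (hS ▸ hm) hm') _)
  refine Set.Finite.of_finite_image (f := fun Γ' => S.filter fun s => -s ∈ Γ')
    (Set.Finite.subset S.powerset.finite_toSet ?_) ?_
  · rintro _ ⟨Γ', -, rfl⟩
    exact Finset.mem_coe.2 (Finset.mem_powerset.2 (Finset.filter_subset _ _))
  · intro Γ₁ h1 Γ₂ h2 h
    exact le_antisymm (key _ _ h1 h2 h) (key _ _ h2 h1 h.symm)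

end Localization

/-! ### From a family of semigroups to a fan. -/

section FanFamily

variable {N : Type} [AddCommGroup N]

/-- A set of semigroups that is closed under localization, and in which the sum of two semigroups
is a localization of both. -/
structure IsFanFamily (𝒢 : Set (AddSubmonoid (Module.Dual ℤ N))) : Prop where
  finite : 𝒢.Finite
  fg : ∀ Γ ∈ 𝒢, Γ.FG
  closure_eq : ∀ Γ ∈ 𝒢, AddSubgroup.closure (Γ : Set (Module.Dual ℤ N)) = ⊤
  loc_mem : ∀ Γ ∈ 𝒢, ∀ Γ', IsLoc Γ Γ' → Γ' ∈ 𝒢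
  sup : ∀ Γ ∈ 𝒢, ∀ Γ' ∈ 𝒢, IsLoc Γ (Γ ⊔ Γ')

/-- The semigroups of an invariant affine cover need not include those of all faces. Closing up
under localization supplies the missing ones and keeps the family finite. -/
theorem isFanFamily_setOf_isLoc {𝒢 : Set (AddSubmonoid (Module.Dual ℤ N))} (hfin : 𝒢.Finite)
    (hfg : ∀ Γ ∈ 𝒢, Γ.FG)
    (hcl : ∀ Γ ∈ 𝒢, AddSubgroup.closure (Γ : Set (Module.Dual ℤ N)) = ⊤)
    (hsup : ∀ Γ ∈ 𝒢, ∀ Γ' ∈ 𝒢, IsLoc Γ (Γ ⊔ Γ')) :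
    IsFanFamily {Γ' | ∃ Γ ∈ 𝒢, IsLoc Γ Γ'} where
  finite := by
    have : {Γ' | ∃ Γ ∈ 𝒢, IsLoc Γ Γ'} = ⋃ Γ ∈ 𝒢, {Γ' | IsLoc Γ Γ'} := by ext; simp
    rw [this]
    exact hfin.biUnion fun Γ hΓ => finite_setOf_isLoc (hfg Γ hΓ)
  fg := fun _ ⟨Γ, hΓ, h⟩ => h.fg (hfg Γ hΓ)
  closure_eq := fun _ ⟨Γ, hΓ, h⟩ => h.closure_eq_top (hcl Γ hΓ)
  loc_mem := fun _ ⟨Γ, hΓ, h⟩ _ h' => ⟨Γ, hΓ, h.trans h'⟩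
  sup := by
    rintro Γ₁ ⟨Γ, hΓ, h⟩ Γ₂ ⟨Γ', hΓ', h'⟩
    -- Since `Γ ≤ Γ₁` and `Γ' ≤ Γ₂`, the passage from `Γ₁` to `Γ₁ ⊔ Γ₂` is the chain `Γ₁ = Γ ⊔ Γ₁`,
    -- `Γ' ⊔ Γ₁`, `Γ₂ ⊔ Γ₁` of two localizations.
    have h1 : IsLoc (Γ ⊔ Γ₁) (Γ ⊔ Γ' ⊔ Γ₁) := (hsup Γ hΓ Γ' hΓ').sup Γ₁
    have h2 : IsLoc (Γ' ⊔ Γ₁) (Γ₂ ⊔ Γ₁) := h'.sup Γ₁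
    rw [sup_eq_right.2 h.le, sup_comm Γ Γ', sup_assoc, sup_eq_right.2 h.le] at h1
    rw [sup_comm Γ₁ Γ₂]
    exact h1.trans h2

theorem IsFanFamily.sup_mem {𝒢 : Set (AddSubmonoid (Module.Dual ℤ N))} (h𝒢 : IsFanFamily 𝒢)
    {Γ Γ' : AddSubmonoid (Module.Dual ℤ N)} (hΓ : Γ ∈ 𝒢) (hΓ' : Γ' ∈ 𝒢) :
    Γ ⊔ Γ' ∈ 𝒢 :=
  h𝒢.loc_mem Γ hΓ _ (h𝒢.sup Γ hΓ Γ' hΓ')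

theorem coneOf_anti {Γ Γ' : AddSubmonoid (Module.Dual ℤ N)} (h : Γ ≤ Γ') : coneOf Γ' ≤ coneOf Γ :=
  fun _ hv => mem_coneOf.2 fun m hm => mem_coneOf.1 hv m (h hm)

theorem coneOf_sup (Γ Γ' : AddSubmonoid (Module.Dual ℤ N)) :
    coneOf (Γ ⊔ Γ') = coneOf Γ ⊓ coneOf Γ' := by
  apply le_antisymm
  · exact le_inf (coneOf_anti le_sup_left) (coneOf_anti le_sup_right)
  · rintro v ⟨h1, h2⟩
    refine mem_coneOf.2 fun m hm => ?_
    obtain ⟨y, hy, z, hz, rfl⟩ := AddSubmonoid.mem_sup.1 hm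
    rw [toReal_add]
    exact add_nonneg (mem_coneOf.1 h1 y hy) (mem_coneOf.1 h2 z hz)

theorem toReal_eq_zero_of_mem_coneOf {Γ : AddSubmonoid (Module.Dual ℤ N)} {m : Module.Dual ℤ N}
    (hm : m ∈ Γ) (hm' : -m ∈ Γ) {v : RealSpace N} (hv : v ∈ coneOf Γ) : toReal m v = 0 := by
  have h1 := mem_coneOf.1 hv m hm
  have h2 := mem_coneOf.1 hv _ hm'
  rw [toReal_neg, LinearMap.neg_apply] at h2
  linarith

theorem mem_coneOf_of_toReal_eq_zero {Γ Γ' : AddSubmonoid (Module.Dual ℤ N)}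
    {m : Module.Dual ℤ N} (hs : ∀ x ∈ Γ', ∃ n : ℕ, x + n • m ∈ Γ) {v : RealSpace N}
    (hv : v ∈ coneOf Γ) (h0 : toReal m v = 0) : v ∈ coneOf Γ' := by
  refine mem_coneOf.2 fun x hx => ?_
  obtain ⟨n, hn⟩ := hs x hx
  have := mem_coneOf.1 hv _ hn
  simpa [toReal_add, toReal_nsmul, h0] using this

/-- The localizing element `m` is a supporting functional: where it vanishes, `x` and `x + n • m`
have the same value, so nonnegativity of `Γ` implies that of `Γ'`. -/
theorem IsLoc.isFace {Γ Γ' : AddSubmonoid (Module.Dual ℤ N)} (h : IsLoc Γ Γ') :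
    IsFace (coneOf Γ') (coneOf Γ) := by
  obtain ⟨h1, m, hm, hm', hs⟩ := h
  refine ⟨toReal m, mem_dualCone.2 fun v hv => mem_coneOf.1 hv m hm, fun v => ⟨fun hv => ?_, ?_⟩⟩
  · exact ⟨coneOf_anti h1 hv, toReal_eq_zero_of_mem_coneOf (h1 hm) hm' hv⟩
  · exact fun ⟨hv, h0⟩ => mem_coneOf_of_toReal_eq_zero hs hv h0

variable [Module.Free ℤ N] [Module.Finite ℤ N]

/-- A face is exposed by some `m ∈ Γ`, not only by a real functional. Inverting `m` adds the
inequality `m ≤ 0` to the cone, which leaves the points where `m = 0`. -/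
theorem exists_isLoc_of_isFace {Γ : AddSubmonoid (Module.Dual ℤ N)} (hΓ : Γ.FG)
    {τ : PointedCone ℝ (RealSpace N)} (h : IsFace τ (coneOf Γ)) :
    ∃ Γ', IsLoc Γ Γ' ∧ coneOf Γ' = τ := by
  obtain ⟨m, hm, hmτ, hmσ, -⟩ := exists_exposing h Γ hΓ (dualCone_coneOf hΓ).symm
  refine ⟨_, isLoc_sup_closure hm, ?_⟩
  rw [coneOf_sup]
  have hv : ∀ v, v ∈ coneOf (AddSubmonoid.closure {-m}) ↔ toReal m v ≤ 0 := fun v => by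
    refine ⟨fun hv => ?_, fun hv => mem_coneOf.2 fun x hx => toReal_nonneg_of_closure ?_ hx⟩
    · have := mem_coneOf.1 hv (-m) (AddSubmonoid.subset_closure (Set.mem_singleton _))
      rw [toReal_neg, LinearMap.neg_apply] at this
      linarith
    · rintro _ rfl
      rw [toReal_neg, LinearMap.neg_apply]
      linarith
  ext v
  refine ⟨fun ⟨h1, h2⟩ => ?_, fun hvτ => ⟨h.le hvτ, (hv v).2 (hmτ v hvτ).le⟩⟩
  exact hmσ v h1 (le_antisymm ((hv v).1 h2) (mem_coneOf.1 h1 m hm))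

/-- This is condition (ii) on `Γ`. Inverting the single `m` already inverts every `f ∈ Γ ∩ τ^⊥`,
because `f` is dominated by a multiple of `m` and `-f = (n • m - f) + n • (-m)`. -/
theorem IsLoc.eq_sup_perpLattice {Γ Γ' : AddSubmonoid (Module.Dual ℤ N)} (h : IsLoc Γ Γ')
    (hΓ : Γ.FG) : Γ' = Γ ⊔ (perpLattice (coneOf Γ') Γ).toAddSubmonoid := by
  obtain ⟨h1, m, hm, hm', hs⟩ := h
  apply le_antisymm
  · intro x hx
    obtain ⟨n, hn⟩ := hs x hx
    have h2 : m ∈ perpLattice (coneOf Γ') Γ := AddSubgroup.subset_closure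
      ⟨hm, fun v hv => toReal_eq_zero_of_mem_coneOf (h1 hm) hm' hv⟩
    have h3 : -(n • m) ∈ perpLattice (coneOf Γ') Γ := neg_mem (nsmul_mem h2 n)
    exact AddSubmonoid.mem_sup.2 ⟨_, hn, _, h3, by abel⟩
  · refine sup_le h1 fun x hx => ?_
    have hx' : x ∈ perpLattice (coneOf Γ') Γ := hx
    clear hx
    unfold perpLattice at hx'
    suffices x ∈ Γ' ∧ -x ∈ Γ' from this.1
    induction hx' using AddSubgroup.closure_induction with
    | mem f hf =>
      obtain ⟨n, hn⟩ := exists_nsmul_sub_mem (isRationalPolyhedral_coneOf hΓ) Γ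
        (dualCone_coneOf hΓ).symm m hm (fun v hv h0 => mem_coneOf_of_toReal_eq_zero hs hv h0)
        f hf.1 hf.2
      refine ⟨h1 hf.1, ?_⟩
      rw [show -f = n • m - f + n • -m by rw [smul_neg]; abel]
      exact add_mem (h1 hn) (nsmul_mem hm' n)
    | zero => simp
    | add a b _ _ iha ihb =>
      exact ⟨add_mem iha.1 ihb.1, by rw [neg_add]; exact add_mem iha.2 ihb.2⟩
    | neg a _ iha => exact ⟨iha.2, by simpa using iha.1⟩

/-- All of `Γ` vanishes on a line contained in the cone, hence so does the group `M` that it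
generates. -/
theorem salient_coneOf {Γ : AddSubmonoid (Module.Dual ℤ N)}
    (hcl : AddSubgroup.closure (Γ : Set (Module.Dual ℤ N)) = ⊤) {v : RealSpace N}
    (hv : v ∈ coneOf Γ) (hv' : -v ∈ coneOf Γ) : v = 0 := by
  have h0 : ∀ m : Module.Dual ℤ N, toReal m v = 0 := fun m => by
    have hm : m ∈ AddSubgroup.closure (Γ : Set (Module.Dual ℤ N)) := hcl ▸ trivial
    induction hm using AddSubgroup.closure_induction with
    | mem x hx =>
      have h1 := mem_coneOf.1 hv x hx
      have h2 := mem_coneOf.1 hv' x hx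
      rw [map_neg] at h2
      linarith
    | zero => simp [toReal_zero]
    | add a b _ _ iha ihb => rw [toReal_add, LinearMap.add_apply, iha, ihb, add_zero]
    | neg a _ iha => rw [toReal_neg, LinearMap.neg_apply, iha, neg_zero]
  obtain ⟨S₀, hS₀⟩ := exists_dual_separating (N := N)
  exact hS₀ v fun s _ => (h0 s).ge

/-- If the cone does not shrink, `-m` lies in the real cone of `Γ`, so some positive multiple `(k +
1) • (-m)` lies in `Γ`. Adding `k • m` gives `-m ∈ Γ` without any saturation. -/
theorem IsLoc.le_of_coneOf_eq {Γ Γ' : AddSubmonoid (Module.Dual ℤ N)} (h : IsLoc Γ Γ')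
    (hΓ : Γ.FG) (hc : coneOf Γ' = coneOf Γ) : Γ' ≤ Γ := by
  obtain ⟨h1, m, hm, hm', hs⟩ := h
  have h2 : toReal (-m) ∈ PointedCone.hull ℝ (toReal '' (Γ : Set (Module.Dual ℤ N))) := by
    rw [← dualCone_coneOf hΓ, mem_dualCone, ← hc]
    exact fun v hv => mem_coneOf.1 hv _ hm'
  obtain ⟨k, hk, hkm⟩ := exists_nsmul_mem_of_mem_hull Γ _ h2
  obtain ⟨k, rfl⟩ : ∃ l, k = l + 1 := ⟨k - 1, by omega⟩
  have h3 : -m ∈ Γ := by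
    rw [show -m = (k + 1) • -m + k • m by rw [succ_nsmul, smul_neg]; abel]
    exact add_mem hkm (nsmul_mem hm _)
  intro x hx
  obtain ⟨n, hn⟩ := hs x hx
  rw [show x = x + n • m + n • -m by rw [smul_neg]; abel]
  exact add_mem hn (nsmul_mem h3 _)

namespace IsFanFamily

variable {𝒢 : Set (AddSubmonoid (Module.Dual ℤ N))}

/-- The sum `Γ ⊔ Γ'` is a localization of both with the same cone, so it equals both. This is what
makes `Γ_σ` a function of `σ`. -/
theorem eq_of_coneOf_eq (h𝒢 : IsFanFamily 𝒢) {Γ Γ' : AddSubmonoid (Module.Dual ℤ N)}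
    (hΓ : Γ ∈ 𝒢) (hΓ' : Γ' ∈ 𝒢) (h : coneOf Γ = coneOf Γ') : Γ = Γ' := by
  have h1 : Γ ⊔ Γ' ≤ Γ := (h𝒢.sup Γ hΓ Γ' hΓ').le_of_coneOf_eq (h𝒢.fg Γ hΓ) (by
    rw [coneOf_sup, h, inf_idem])
  have h2 : Γ' ⊔ Γ ≤ Γ' := (h𝒢.sup Γ' hΓ' Γ hΓ).le_of_coneOf_eq (h𝒢.fg Γ' hΓ') (by
    rw [coneOf_sup, h, inf_idem])
  exact le_antisymm (le_sup_right.trans h2) (le_sup_right.trans h1)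

/-- The semigroups of the family are the semigroups `Γ_σ` for a unique fan. -/
theorem exists_toricData (h𝒢 : IsFanFamily 𝒢) : ∃ D : ToricData N,
    (∀ σ, D.Γ σ ∈ 𝒢) ∧ (∀ Γ ∈ 𝒢, ∃ σ, D.Γ σ = Γ) ∧ ∀ σ, coneOf (D.Γ σ) = σ.1 := by
  classical
  have hmem : ∀ σ, σ ∈ (h𝒢.finite.image coneOf).toFinset ↔ ∃ Γ ∈ 𝒢, coneOf Γ = σ := by simp
  choose! G hG hGσ using fun σ => (hmem σ).1
  let F : Fan N :=
    { cones := (h𝒢.finite.image coneOf).toFinset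
      polyhedral := fun σ hσ => by
        rw [← hGσ σ hσ]; exact isRationalPolyhedral_coneOf (h𝒢.fg _ (hG σ hσ))
      salient := fun σ hσ v hv hv' => by
        rw [← hGσ σ hσ] at hv hv'
        exact salient_coneOf (h𝒢.closure_eq _ (hG σ hσ)) hv hv'
      face_mem := fun σ hσ τ hτ => by
        rw [← hGσ σ hσ] at hτ
        obtain ⟨Γ', h, rfl⟩ := exists_isLoc_of_isFace (h𝒢.fg _ (hG σ hσ)) hτ
        exact (hmem _).2 ⟨Γ', h𝒢.loc_mem _ (hG σ hσ) _ h, rfl⟩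
      inter_face := fun σ hσ σ' hσ' => by
        have h1 := (h𝒢.sup _ (hG σ hσ) _ (hG σ' hσ')).isFace
        have h2 := (h𝒢.sup _ (hG σ' hσ') _ (hG σ hσ)).isFace
        rw [coneOf_sup, hGσ σ hσ, hGσ σ' hσ'] at h1 h2
        exact ⟨h1, inf_comm σ σ' ▸ h2⟩ }
  refine ⟨{ toFan := F
            Γ := fun σ => G σ.1
            fg := fun σ => h𝒢.fg _ (hG _ σ.2)
            closure_eq := fun σ => h𝒢.closure_eq _ (hG _ σ.2)
            hull_eq := fun σ => by
              rw [← dualCone_coneOf (h𝒢.fg _ (hG _ σ.2)), hGσ _ σ.2]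
            compat := fun σ τ hτ => ?_ }, fun σ => hG _ σ.2, fun Γ hΓ => ?_, fun σ => hGσ _ σ.2⟩
  -- The localization of `Γ_σ` with cone `τ` belongs to the family, so it is the chosen `Γ_τ`.
  · have hfg := h𝒢.fg _ (hG _ σ.2)
    rw [← hGσ _ σ.2] at hτ
    obtain ⟨Γ', h, hΓ'⟩ := exists_isLoc_of_isFace hfg hτ
    have h1 : Γ' = G τ.1 := h𝒢.eq_of_coneOf_eq (h𝒢.loc_mem _ (hG _ σ.2) _ h) (hG _ τ.2) (by
      rw [hΓ', hGσ _ τ.2])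
    rw [h1] at h
    have := h.eq_sup_perpLattice hfg
    rwa [hGσ _ τ.2] at this
  · have h1 : coneOf Γ ∈ F.cones := (hmem _).2 ⟨Γ, hΓ, rfl⟩
    exact ⟨⟨coneOf Γ, h1⟩, h𝒢.eq_of_coneOf_eq (hG _ h1) hΓ (hGσ _ h1)⟩

end IsFanFamily

end FanFamily

/-! ### Open immersions between affine toric charts are localizations. -/

section OpenImmersion

/-- An open immersion of an integral affine scheme into an affine scheme is locally the inclusion of
a basic open subset. -/
theorem exists_pow_mul_mem_range {A B : CommRingCat.{u}} [IsDomain B] (φ : A ⟶ B)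
    [IsOpenImmersion (Spec.map φ)] (q : Spec B) :
    ∃ f : A, φ.hom f ∉ q.asIdeal ∧ ∀ b, ∃ (n : ℕ) (a : A), φ.hom f ^ n * b = φ.hom a := by
  obtain ⟨_, ⟨_, ⟨f, rfl⟩, rfl⟩, hqf, hf⟩ :=
    (PrimeSpectrum.isBasis_basic_opens (R := A)).exists_subset_of_mem_open
      (show Spec.map φ q ∈ (Spec.map φ).opensRange from ⟨q, rfl⟩) (Spec.map φ).opensRange.2
  refine ⟨f, hqf, ?_⟩
  let L := Localization.Away f
  let i : A ⟶ .of L := CommRingCat.ofHom (algebraMap A L)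
  have hi : IsOpenImmersion (Spec.map i) := IsOpenImmersion.of_isLocalization (S := L) f
  have hr : Set.range (Spec.map i) ⊆ Set.range (Spec.map φ) := by
    have := PrimeSpectrum.localization_away_comap_range L f
    intro x hx
    exact hf (this.subset hx)
  -- As `D(f)` lies in the image of `Spec B`, its inclusion lifts to `Spec B`, which gives `B →
  -- A_f`.
  let ψ : B ⟶ .of L := Spec.preimage (IsOpenImmersion.lift (Spec.map φ) (Spec.map i) hr)
  have hψ : φ ≫ ψ = i := by
    apply Spec.map_injective
    rw [Spec.map_comp, Spec.map_preimage, IsOpenImmersion.lift_fac]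
  have hψ' : ∀ a, ψ.hom (φ.hom a) = algebraMap A L a := fun a => by
    rw [← CommRingCat.comp_apply, hψ]; rfl
  let L' := Localization.Away (φ.hom f)
  have h0 : φ.hom f ≠ 0 := fun h => hqf (by
    show φ.hom f ∈ q.asIdeal
    rw [h]; exact zero_mem _)
  -- The composite `B → A_f → B_f` is the localization map, as can be tested after `φ` because
  -- `Spec.map φ` is a monomorphism. It is injective since `B` is a domain, hence so is `ψ`, and
  -- relations can be pulled back from `A_f` to `B`.
  let χ : CommRingCat.of L ⟶ .of L' := CommRingCat.ofHom (IsLocalization.Away.lift f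
    (g := (algebraMap B L').comp φ.hom) (IsLocalization.Away.algebraMap_isUnit (φ.hom f)))
  have hχ : ψ ≫ χ = CommRingCat.ofHom (algebraMap B L') := by
    apply Spec.map_injective
    rw [← cancel_mono (Spec.map φ), ← Spec.map_comp, ← Spec.map_comp, ← Category.assoc, hψ]
    congr 1
    ext a
    exact IsLocalization.Away.lift_eq f (IsLocalization.Away.algebraMap_isUnit (φ.hom f)) a
  have hinj : Function.Injective ψ.hom := fun a b hab => by
    have h1 : algebraMap B L' a = algebraMap B L' b := by
      have := congrArg χ.hom hab
      rwa [← CommRingCat.comp_apply, ← CommRingCat.comp_apply, hχ] at this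
    exact IsLocalization.injective L' (powers_le_nonZeroDivisors_of_noZeroDivisors h0) h1
  intro b
  obtain ⟨n, a, h⟩ := IsLocalization.Away.surj f (ψ.hom b)
  refine ⟨n, a, hinj ?_⟩
  rw [map_mul, map_pow, hψ', hψ', ← h, mul_comm]

variable {k : Type u} [Field k] {M : Type} [AddCommGroup M]

theorem inclusion_mapDomain_mem_support {Γ Γ' : AddSubmonoid M} (h : Γ ≤ Γ')
    (a : AddMonoidAlgebra k Γ) {x : Γ'}
    (hx : x ∈ (AddMonoidAlgebra.mapDomain (AddSubmonoid.inclusion h) a).coeff.support) :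
    (x : M) ∈ Γ := by
  classical
  obtain ⟨y, -, rfl⟩ := Finset.mem_image.1 (Finsupp.mapDomain_support hx)
  exact y.2

theorem isDomain_of_submonoid [IsDomain (AddMonoidAlgebra k M)] (Γ : AddSubmonoid M) :
    IsDomain (AddMonoidAlgebra k Γ) :=
  (AddMonoidAlgebra.mapDomain_injective (R := k) (f := Γ.subtype)
    Subtype.val_injective).isDomain (AddMonoidAlgebra.mapDomainRingHom k Γ.subtype)

/-- Locally on `T^{Γ'}` some function from `k[Γ]` serves as a denominator for the generators of
`Γ'`, so the denominators generate the unit ideal. Comparing coefficients of `1` then yields a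
monomial denominator `t^m` that is a unit in `k[Γ']`. -/
theorem isLoc_of_isOpenImmersion [IsDomain (AddMonoidAlgebra k M)] {Γ Γ' : AddSubmonoid M}
    (h : Γ ≤ Γ') (hΓ' : Γ'.FG)
    [IsOpenImmersion (affineToricMap k (AddSubmonoid.inclusion h)).left] : IsLoc Γ Γ' := by
  classical
  obtain ⟨S, hS⟩ := hΓ'
  have hSΓ : ∀ s ∈ S, s ∈ Γ' := fun s hs => hS ▸ AddSubmonoid.subset_closure hs
  have := isDomain_of_submonoid (k := k) Γ'
  let φ : CommRingCat.of (AddMonoidAlgebra k Γ) ⟶ .of (AddMonoidAlgebra k Γ') :=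
    CommRingCat.ofHom (AddMonoidAlgebra.mapDomainAlgHom k k (AddSubmonoid.inclusion h)).toRingHom
  have : IsOpenImmersion (Spec.map φ) :=
    inferInstanceAs (IsOpenImmersion (affineToricMap k (AddSubmonoid.inclusion h)).left)
  -- The common denominators: elements of `k[Γ]` that bring every generator `t^s` of `k[Γ']` into
  -- `k[Γ]`.
  let J : Set (AddMonoidAlgebra k Γ') := {x | (∃ a, φ.hom a = x) ∧
    ∀ (s : M) (hs : s ∈ S), ∃ a, φ.hom a = x * AddMonoidAlgebra.single ⟨s, hSΓ s hs⟩ 1}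
  have hJ : Ideal.span J = ⊤ := by
    by_contra hne
    obtain ⟨q, hq, hJq⟩ := Ideal.exists_le_maximal _ hne
    obtain ⟨f, hf, hb⟩ := exists_pow_mul_mem_range φ ⟨q, hq.isPrime⟩
    choose n a ha using fun s : {s // s ∈ S} =>
      hb (AddMonoidAlgebra.single ⟨s.1, hSΓ s.1 s.2⟩ 1)
    -- Each generator needs its own power of `f`. The sum of the exponents clears all of them at
    -- once, and this power of `f` still avoids the prime `q`.
    refine hf (hq.isPrime.mem_of_pow_mem (∑ s, n s) (hJq (Ideal.subset_span ⟨⟨f ^ ∑ s, n s, ?_⟩,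
      fun s hs => ⟨f ^ (∑ s ∈ Finset.univ.erase ⟨s, hs⟩, n s) * a ⟨s, hs⟩, ?_⟩⟩)))
    · rw [map_pow]
    · rw [map_mul, ← ha, ← mul_assoc, map_pow, ← pow_add,
        Finset.sum_erase_add _ _ (Finset.mem_univ _)]
  -- Every monomial of an element of `J` is itself a denominator, since multiplication by `t^s` only
  -- shifts the support. So a monomial occurring in the ideal is a monomial denominator times an
  -- element of `k[Γ']`.
  have key : ∀ x ∈ Ideal.span J, ∀ y ∈ x.coeff.support, ∃ m ∈ Γ, (∀ s ∈ S, m + s ∈ Γ) ∧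
      (y : M) - m ∈ Γ' := by
    intro x hx
    induction hx using Submodule.span_induction with
    | mem x hx =>
      intro y hy
      obtain ⟨⟨a, rfl⟩, hs⟩ := hx
      refine ⟨y, inclusion_mapDomain_mem_support h a hy, fun s hsS => ?_, by simp⟩
      obtain ⟨b, hb⟩ := hs s hsS
      have : y + ⟨s, hSΓ s hsS⟩ ∈ (φ.hom b : AddMonoidAlgebra k Γ').coeff.support := by
        rw [hb, Finsupp.mem_support_iff]
        have := AddMonoidAlgebra.coeff_mul_single_eq_coeff_mul (x := φ.hom a) (r := (1 : k))
          (m := (⟨s, hSΓ s hsS⟩ : Γ')) (m₁ := y + ⟨s, hSΓ s hsS⟩) y (fun z _ => by simp)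
        rw [this, mul_one]
        exact Finsupp.mem_support_iff.1 hy
      exact inclusion_mapDomain_mem_support h b this
    | zero => simp
    | add x y _ _ hx hy =>
      intro z hz
      rcases Finset.mem_union.1 (Finsupp.support_add hz) with hz | hz
      · exact hx z hz
      · exact hy z hz
    | smul a x _ hx =>
      intro z hz
      obtain ⟨b, -, c, hc, rfl⟩ := Finset.mem_add.1 (AddMonoidAlgebra.support_coeff_mul_subset a x hz)
      obtain ⟨m, hm, hmS, hcm⟩ := hx c hc
      exact ⟨m, hm, hmS, by
        rw [AddSubmonoid.coe_add, add_sub_assoc]; exact add_mem b.2 hcm⟩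
  -- For the exponent `0` of `1` the condition `y - m ∈ Γ'` reads `-m ∈ Γ'`.
  obtain ⟨m, hm, hmS, hm'⟩ := key 1 (hJ ▸ trivial) 0 (by
    rw [Finsupp.mem_support_iff, AddMonoidAlgebra.one_def]; simp)
  refine ⟨h, m, hm, by simpa using hm', fun x hx => ?_⟩
  rw [← hS] at hx
  induction hx using AddSubmonoid.closure_induction with
  | mem s hs => exact ⟨1, by rw [one_nsmul, add_comm]; exact hmS s hs⟩
  | zero => exact ⟨0, by simp⟩
  | add x y _ _ hx hy =>
    obtain ⟨a, ha⟩ := hx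
    obtain ⟨b, hb⟩ := hy
    refine ⟨a + b, ?_⟩
    rw [show x + y + (a + b) • m = (x + a • m) + (y + b • m) by rw [add_nsmul]; abel]
    exact add_mem ha hb

end OpenImmersion

/-! ### Stable subalgebras of the coordinate ring of the torus. -/

section Comodule

variable {k : Type u} [Field k] {M : Type} [AddCommGroup M] {A : Type u} [CommRing A] [Algebra k A]

/-- The `k`-linear map `k[M] ⊗ B → B` given by the coefficient at `m`. -/
noncomputable def coeffTensor (k : Type u) [Field k] {M : Type} [AddCommGroup M] (B : Type u)
    [CommRing B] [Algebra k B] (m : M) : AddMonoidAlgebra k M ⊗[k] B →ₗ[k] B :=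
  (TensorProduct.lid k B).toLinearMap ∘ₗ LinearMap.rTensor B
    ((Finsupp.lapply m).comp (AddMonoidAlgebra.coeffLinearEquiv k).toLinearMap)

theorem coeffTensor_tmul {B : Type u} [CommRing B] [Algebra k B] (m : M)
    (x : AddMonoidAlgebra k M) (b : B) : coeffTensor k B m (x ⊗ₜ b) = x.coeff m • b := by
  simp [coeffTensor]

/-- Because `t^g ↦ t^g ⊗ t^g`, the coefficient at `m` in the first factor projects onto the
homogeneous component of degree `m`. -/
theorem coeffTensor_comul (m : M) (x : AddMonoidAlgebra k M) :
    coeffTensor k (AddMonoidAlgebra k M) m (Bialgebra.comulAlgHom k (AddMonoidAlgebra k M) x) =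
      AddMonoidAlgebra.single m (x.coeff m) := by
  classical
  induction x using AddMonoidAlgebra.induction_linear with
  | zero => simp
  | add x y hx hy => rw [map_add, map_add, hx, hy]; simp
  | single g r =>
    rw [show AddMonoidAlgebra.single g r = r • AddMonoidAlgebra.single g (1 : k) by simp, map_smul,
      map_smul, Bialgebra.comulAlgHom_apply, AddMonoidAlgebra.comul_single]
    simp only [CommSemiring.comul_apply, TensorProduct.map_tmul, coeffTensor_tmul]
    by_cases h : g = m
    · subst h; simp
    · simp [h]

theorem coeffTensor_map (i : A →ₐ[k] AddMonoidAlgebra k M) (m : M)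
    (x : AddMonoidAlgebra k M ⊗[k] A) :
    coeffTensor k (AddMonoidAlgebra k M) m
      (Algebra.TensorProduct.map (AlgHom.id k (AddMonoidAlgebra k M)) i x) =
      i (coeffTensor k A m x) := by
  induction x with
  | zero => simp
  | add x y hx hy => simp [hx, hy]
  | tmul x y => simp [coeffTensor_tmul]

/-- The semigroup of the characters that belong to a subalgebra of `k[M]`. -/
def characters (S : Subalgebra k (AddMonoidAlgebra k M)) : AddSubmonoid M where
  carrier := {m | AddMonoidAlgebra.single m 1 ∈ S}
  zero_mem' := S.one_mem
  add_mem' {a b} ha hb := by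
    have := S.mul_mem ha hb
    rwa [AddMonoidAlgebra.single_mul_single, one_mul] at this

/-- A subalgebra of `k[M]` that is stable under the coaction is spanned by characters. -/
theorem range_eq_of_comodule (i : A →ₐ[k] AddMonoidAlgebra k M)
    (c : A →ₐ[k] AddMonoidAlgebra k M ⊗[k] A)
    (hc : (Algebra.TensorProduct.map (AlgHom.id k (AddMonoidAlgebra k M)) i).comp c =
      (Bialgebra.comulAlgHom k (AddMonoidAlgebra k M)).comp i) :
    (AddMonoidAlgebra.mapDomainAlgHom k k (characters i.range).subtype).range = i.range := by
  apply le_antisymm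
  · rintro _ ⟨x, rfl⟩
    induction x using AddMonoidAlgebra.induction_linear with
    | zero => simp
    | add x y hx hy => rw [map_add]; exact add_mem hx hy
    | single g r =>
      have h1 : AddMonoidAlgebra.single (g : M) (1 : k) ∈ i.range := g.2
      have h2 := i.range.smul_mem h1 r
      simpa using h2
  · rintro _ ⟨x, rfl⟩
    -- The component of `i x` of degree `m` is the image of an explicit element of `A`, the
    -- coefficient at `m` of `c x`.
    have hx : ∀ m, AddMonoidAlgebra.single m ((i x).coeff m) ∈ i.range := fun m => by
      refine ⟨coeffTensor k A m (c x), ?_⟩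
      have h1 := coeffTensor_map i m (c x)
      have h2 := DFunLike.congr_fun hc x
      rw [AlgHom.comp_apply, AlgHom.comp_apply] at h2
      rw [h2, coeffTensor_comul] at h1
      exact h1.symm
    show i x ∈ _
    rw [← AddMonoidAlgebra.sum_coeff_single (i x)]
    refine sum_mem fun m hm => ?_
    -- Dividing the component by its nonzero coefficient leaves the character itself.
    have hm' : m ∈ characters i.range := by
      have := i.range.smul_mem (hx m) ((i x).coeff m)⁻¹
      rw [AddMonoidAlgebra.smul_single, smul_eq_mul,
        inv_mul_cancel₀ (Finsupp.mem_support_iff.1 hm)] at this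
      exact this
    exact ⟨AddMonoidAlgebra.single ⟨m, hm'⟩ ((i x).coeff m), by simp⟩

/-- A comodule subalgebra of `k[M]` is the semigroup algebra of the semigroup of its characters. -/
theorem exists_algEquiv_of_comodule (i : A →ₐ[k] AddMonoidAlgebra k M)
    (hi : Function.Injective i) (c : A →ₐ[k] AddMonoidAlgebra k M ⊗[k] A)
    (hc : (Algebra.TensorProduct.map (AlgHom.id k (AddMonoidAlgebra k M)) i).comp c =
      (Bialgebra.comulAlgHom k (AddMonoidAlgebra k M)).comp i) :
    ∃ e : A ≃ₐ[k] AddMonoidAlgebra k (characters i.range),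
      (AddMonoidAlgebra.mapDomainAlgHom k k (characters i.range).subtype).comp e.toAlgHom = i := by
  have hinj : Function.Injective
      (AddMonoidAlgebra.mapDomainAlgHom k k (characters i.range).subtype) :=
    AddMonoidAlgebra.mapDomain_injective Subtype.val_injective
  let e := ((AlgEquiv.ofInjective i hi).trans
    (Subalgebra.equivOfEq _ _ (range_eq_of_comodule i c hc).symm)).trans
    (AlgEquiv.ofInjective _ hinj).symm
  refine ⟨e, AlgHom.ext fun a => ?_⟩
  have : AlgEquiv.ofInjective _ hinj (e a) =
      Subalgebra.equivOfEq _ _ (range_eq_of_comodule i c hc).symm (AlgEquiv.ofInjective i hi a) := by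
    simp [e]
  exact congrArg Subtype.val this

end Comodule

/-! ### Dictionary between affine schemes over `k` and `k`-algebras. -/

noncomputable section SpecOver

variable (k : Type u) [Field k]

/-- The affine scheme `Spec A` over `k` of a `k`-algebra. -/
abbrev specOver (A : Type u) [CommRing A] [Algebra k A] : Over (Spec (.of k)) :=
  Over.mk (Spec.map (CommRingCat.ofHom (algebraMap k A)))

variable {k} {A B C : Type u} [CommRing A] [Algebra k A] [CommRing B] [Algebra k B] [CommRing C]
  [Algebra k C]

/-- The morphism of affine schemes over `k` of a homomorphism of `k`-algebras. -/
def specMap (f : A →ₐ[k] B) : specOver k B ⟶ specOver k A :=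
  Over.homMk (Spec.map (CommRingCat.ofHom f.toRingHom)) (by
    simp only [Over.mk_hom, ← Spec.map_comp, ← CommRingCat.ofHom_comp]
    congr 2
    exact f.comp_algebraMap)

theorem specMap_comp (f : A →ₐ[k] B) (g : B →ₐ[k] C) :
    specMap (g.comp f) = specMap g ≫ specMap f := by
  ext1
  exact Spec.map_comp (CommRingCat.ofHom f.toRingHom) (CommRingCat.ofHom g.toRingHom)

theorem specMap_id : specMap (AlgHom.id k A) = 𝟙 (specOver k A) := by
  ext1
  exact Spec.map_id _

theorem exists_specMap_eq (g : specOver k B ⟶ specOver k A) : ∃ f : A →ₐ[k] B, specMap f = g := by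
  have h : CommRingCat.ofHom (algebraMap k A) ≫ Spec.preimage g.left =
      CommRingCat.ofHom (algebraMap k B) := by
    apply Spec.map_injective
    rw [Spec.map_comp, Spec.map_preimage]
    exact Over.w g
  refine ⟨{ (Spec.preimage g.left).hom with
    commutes' := fun r => congrArg (fun φ => φ.hom r) h }, ?_⟩
  ext1
  exact Spec.map_preimage g.left

theorem specMap_injective : Function.Injective (specMap : (A →ₐ[k] B) → _) := fun f g h => by
  have := Spec.map_injective (congrArg CommaMorphism.left h)
  exact AlgHom.ext fun a => congrArg (fun φ => φ.hom a) this

instance isIso_specMap (e : A ≃ₐ[k] B) : IsIso (specMap e.toAlgHom) := by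
  refine ⟨specMap e.symm.toAlgHom, ?_, ?_⟩
  · rw [← specMap_comp, ← specMap_id]; congr 1; ext x; simp
  · rw [← specMap_comp, ← specMap_id]; congr 1; ext x; simp

/-- The product of two affine schemes over `k`. -/
def specProd : specOver k (A ⊗[k] B) ≅ specOver k A ⊗ specOver k B :=
  Over.isoMk (pullbackSpecIso k A B).symm (by
    rw [← cancel_epi (pullbackSpecIso k A B).hom]
    simp only [Iso.symm_hom, Iso.hom_inv_id_assoc]
    exact (pullbackSpecIso_hom_base k A B).symm)

theorem specProd_fst : (specProd (k := k) (A := A) (B := B)).hom ≫ CartesianMonoidalCategory.fst _ _ =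
    specMap Algebra.TensorProduct.includeLeft := by
  ext1
  exact pullbackSpecIso_inv_fst k A B

theorem specProd_snd : (specProd (k := k) (A := A) (B := B)).hom ≫ CartesianMonoidalCategory.snd _ _ =
    specMap Algebra.TensorProduct.includeRight := by
  ext1
  exact pullbackSpecIso_inv_snd k A B

theorem specProd_map {A' B' : Type u} [CommRing A'] [Algebra k A'] [CommRing B'] [Algebra k B']
    (f : A →ₐ[k] A') (g : B →ₐ[k] B') :
    specMap (Algebra.TensorProduct.map f g) ≫ specProd.hom =
      specProd.hom ≫ (specMap f ⊗ₘ specMap g) := by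
  apply CartesianMonoidalCategory.hom_ext
  · rw [Category.assoc, Category.assoc, specProd_fst, CartesianMonoidalCategory.tensorHom_fst,
      ← Category.assoc, specProd_fst, ← specMap_comp, ← specMap_comp]
    congr 1
    ext x
    simp
  · rw [Category.assoc, Category.assoc, specProd_snd, CartesianMonoidalCategory.tensorHom_snd,
      ← Category.assoc, specProd_snd, ← specMap_comp, ← specMap_comp]
    congr 1
    ext x
    simp

theorem specProd_whiskerLeft {B' : Type u} [CommRing B'] [Algebra k B'] (g : B →ₐ[k] B') :
    specMap (Algebra.TensorProduct.map (AlgHom.id k A) g) ≫ specProd.hom =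
      specProd.hom ≫ (specOver k A ◁ specMap g) := by
  rw [specProd_map, specMap_id, id_tensorHom]

theorem affineToricMap_eq_specMap {G H : Type} [AddCommMonoid G] [AddCommMonoid H] (f : G →+ H) :
    affineToricMap k f = specMap (AddMonoidAlgebra.mapDomainAlgHom k k f) := rfl

/-- With `specProd_affineAction`, this reduces identities between morphisms out of a product to
identities of algebra homomorphisms, which can be checked on characters. -/
theorem specProd_mul (M : Type) [AddCommGroup M] :
    specProd.hom ≫ μ[torus k M] = specMap (Bialgebra.comulAlgHom k (AddMonoidAlgebra k M)) := by
  ext1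
  have := mul_spec_asOver_spec_left (R := CommRingCat.of k) (A := CommRingCat.of (AddMonoidAlgebra k M))
  rw [Over.comp_left]
  refine (congrArg (_ ≫ ·) this).trans ?_
  exact Iso.inv_hom_id_assoc (pullbackSpecIso k _ _) _

theorem specProd_affineAction {M : Type} [AddCommGroup M] (Γ : AddSubmonoid M) :
    specProd.hom ≫ affineAction k Γ = specMap (coaction k Γ) := by
  ext1
  exact Iso.inv_hom_id_assoc (pullbackSpecIso k _ _) _

end SpecOver

/-! ### Toric charts and their intersections. -/

section Charts

variable {k : Type u} [Field k]

theorem isDominant_specMap {A B : Type u} [CommRing A] [Algebra k A] [CommRing B] [Algebra k B]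
    (f : A →ₐ[k] B) (hf : Function.Injective f) : IsDominant (specMap f).left := by
  refine ⟨?_⟩
  have := (PrimeSpectrum.denseRange_comap_iff_ker_le_nilRadical f.toRingHom).2 (by
    rw [(RingHom.injective_iff_ker_eq_bot f.toRingHom).1 hf]
    exact bot_le)
  exact this

variable {M : Type} [AddCommGroup M] {X : Over (Spec (.of k))} (t : torus k M ⟶ X)

/-- A toric chart of `X`: an open immersion `T^Γ ⟶ X` that extends the embedding `t` of the
torus. -/
structure IsChart (Γ : AddSubmonoid M) (χ : affineToric k Γ ⟶ X) : Prop where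
  isOpenImmersion : IsOpenImmersion χ.left
  fac : affineToricMap k Γ.subtype ≫ χ = t

variable {t}

theorem inclusion_comp_chart {Γ Γ' : AddSubmonoid M} (h : Γ ≤ Γ') :
    affineToricMap k Γ'.subtype ≫ affineToricMap k (AddSubmonoid.inclusion h) =
      affineToricMap k Γ.subtype := by
  rw [← affineToricMap_comp]
  rfl

theorem isDominant_subtype (Γ : AddSubmonoid M) :
    IsDominant (affineToricMap k Γ.subtype).left :=
  isDominant_specMap _ (AddMonoidAlgebra.mapDomain_injective Subtype.val_injective)

theorem IsChart.of_isLoc {Γ Γ' : AddSubmonoid M} {χ : affineToric k Γ ⟶ X} (hχ : IsChart t Γ χ)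
    (h : IsLoc Γ Γ') : IsChart t Γ' (affineToricMap k (AddSubmonoid.inclusion h.le) ≫ χ) where
  isOpenImmersion := by
    have := hχ.isOpenImmersion
    obtain ⟨m, hm, hm', hs⟩ := h.2
    have := isOpenImmersion_affineToricMap k h.le m hm hm' hs
    rw [Over.comp_left]
    infer_instance
  fac := by rw [← Category.assoc, inclusion_comp_chart, hχ.fac]

/-- A chart is open in `X`, so `k[Γ]` is of finite type, which forces `Γ` to be finitely generated.
-/
theorem IsChart.fg [LocallyOfFiniteType X.hom] {Γ : AddSubmonoid M} {χ : affineToric k Γ ⟶ X}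
    (hχ : IsChart t Γ χ) : Γ.FG := by
  have := hχ.isOpenImmersion
  have h1 : LocallyOfFiniteType (affineToric k Γ).hom := by
    rw [← Over.w χ]; infer_instance
  have h2 : (algebraMap k (AddMonoidAlgebra k Γ)).FiniteType :=
    (HasRingHomProperty.Spec_iff (P := @LocallyOfFiniteType)).1 h1
  have h3 : Algebra.FiniteType k (AddMonoidAlgebra k Γ) := RingHom.finiteType_algebraMap.1 h2
  exact (AddMonoid.fg_iff_addSubmonoid_fg Γ).1 (AddMonoidAlgebra.fg_of_finiteType (R := k))

/-- The morphism `Y ×_S Z → Y ×_T Z` is a base change of the diagonal of `S` over `T`. The structure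
maps `p`, `q` are kept as variables so that the result applies to objects over a base. -/
theorem isClosedImmersion_lift_of_isSeparated {Y Z S T : Scheme.{u}} (f : Y ⟶ S) (g : Z ⟶ S)
    (i : S ⟶ T) [IsSeparated i] (p : Y ⟶ T) (q : Z ⟶ T) (hp : f ≫ i = p) (hq : g ≫ i = q)
    (w : pullback.fst f g ≫ p = pullback.snd f g ≫ q) :
    IsClosedImmersion (pullback.lift (f := p) (g := q) (pullback.fst f g) (pullback.snd f g) w) := by
  subst hp hq
  convert (inferInstance : IsClosedImmersion (pullback.mapDesc f g i)) using 1
  apply pullback.hom_ext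
  · exact (pullback.lift_fst ..).trans ((pullback.lift_fst ..).trans (Category.comp_id _)).symm
  · exact (pullback.lift_snd ..).trans ((pullback.lift_snd ..).trans (Category.comp_id _)).symm

/-- Every monomial of `k[Γ + Γ']` is a product of one from each factor, so `k[Γ] ⊗ k[Γ'] → k[Γ +
Γ']` is surjective. -/
theorem isClosedImmersion_lift_inclusion (Γ Γ' : AddSubmonoid M) :
    IsClosedImmersion (CartesianMonoidalCategory.lift
      (affineToricMap k (AddSubmonoid.inclusion (le_sup_left : Γ ≤ Γ ⊔ Γ')))
      (affineToricMap k (AddSubmonoid.inclusion (le_sup_right : Γ' ≤ Γ ⊔ Γ')))).left := by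
  let f := Algebra.TensorProduct.productMap
    (AddMonoidAlgebra.mapDomainAlgHom k k (AddSubmonoid.inclusion (le_sup_left : Γ ≤ Γ ⊔ Γ')))
    (AddMonoidAlgebra.mapDomainAlgHom k k (AddSubmonoid.inclusion (le_sup_right : Γ' ≤ Γ ⊔ Γ')))
  have hf : Function.Surjective f := by
    intro x
    induction x using AddMonoidAlgebra.induction_linear with
    | zero => exact ⟨0, map_zero _⟩
    | add x y hx hy =>
      obtain ⟨a, rfl⟩ := hx
      obtain ⟨b, rfl⟩ := hy
      exact ⟨a + b, map_add _ _ _⟩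
    | single g r =>
      obtain ⟨y, hy, z, hz, h⟩ := AddSubmonoid.mem_sup.1 g.2
      refine ⟨AddMonoidAlgebra.single ⟨y, hy⟩ r ⊗ₜ AddMonoidAlgebra.single ⟨z, hz⟩ 1, ?_⟩
      have : AddSubmonoid.inclusion (le_sup_left : Γ ≤ Γ ⊔ Γ') ⟨y, hy⟩ +
          AddSubmonoid.inclusion (le_sup_right : Γ' ≤ Γ ⊔ Γ') ⟨z, hz⟩ = g := Subtype.ext h
      simp [f, AddMonoidAlgebra.single_mul_single, this]
  have h : CartesianMonoidalCategory.lift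
      (affineToricMap k (AddSubmonoid.inclusion (le_sup_left : Γ ≤ Γ ⊔ Γ')))
      (affineToricMap k (AddSubmonoid.inclusion (le_sup_right : Γ' ≤ Γ ⊔ Γ'))) =
      specMap f ≫ specProd.hom := by
    apply CartesianMonoidalCategory.hom_ext
    · rw [CartesianMonoidalCategory.lift_fst, Category.assoc, specProd_fst, ← specMap_comp,
        affineToricMap_eq_specMap, Algebra.TensorProduct.productMap_left]
    · rw [CartesianMonoidalCategory.lift_snd, Category.assoc, specProd_snd, ← specMap_comp,
        affineToricMap_eq_specMap]
      congr 1
      exact (Algebra.TensorProduct.productMap_right _ _).symm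
  have h1 : IsClosedImmersion (specMap f).left := IsClosedImmersion.spec_of_surjective _ hf
  have h2 : IsIso (specProd (k := k) (A := AddMonoidAlgebra k Γ)
      (B := AddMonoidAlgebra k Γ')).hom.left :=
    inferInstanceAs (IsIso ((Over.forget _).map specProd.hom))
  rw [h, Over.comp_left]
  infer_instance

/-- A dominant morphism to a reduced scheme is schematically dominant. Hence a reduced closed
subscheme can be recovered from a dense piece such as the torus. -/
theorem ker_comp_eq_of_isDominant {W P Q : Scheme.{u}} [IsReduced P] (a : W ⟶ P) [IsDominant a]
    (i : P ⟶ Q) : (a ≫ i).ker = i.ker := by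
  have := IsSchemeTheoreticallyDominant.of_isDominant a
  rw [Scheme.Hom.ker_comp, a.ker_eq_bot, Scheme.IdealSheafData.map_bot]

variable [IsDomain (AddMonoidAlgebra k M)]

instance isIntegral_affineToric (Γ : AddSubmonoid M) : IsIntegral (affineToric k Γ).left := by
  have := isDomain_of_submonoid (k := k) Γ
  exact inferInstanceAs (IsIntegral (Spec (.of (AddMonoidAlgebra k Γ))))

/-- The torus is open in the chart, so all of `M` is a localization of `Γ`; then every character is
a difference of elements of `Γ`. -/
theorem IsChart.closure_eq_top [IsOpenImmersion t.left] (hM : AddMonoid.FG M) {Γ : AddSubmonoid M}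
    {χ : affineToric k Γ ⟶ X} (hχ : IsChart t Γ χ) : AddSubgroup.closure (Γ : Set M) = ⊤ := by
  have := hχ.isOpenImmersion
  have h1 : IsOpenImmersion ((affineToricMap k Γ.subtype).left ≫ χ.left) := by
    rw [← Over.comp_left, hχ.fac]; infer_instance
  have h2 : IsOpenImmersion (affineToricMap k Γ.subtype).left := IsOpenImmersion.of_comp _ χ.left
  let e : M →+ (⊤ : AddSubmonoid M) := AddSubmonoid.topEquiv.symm.toAddMonoidHom
  let e' : (⊤ : AddSubmonoid M) →+ M := AddSubmonoid.topEquiv.toAddMonoidHom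
  have h3 : IsIso (affineToricMap k e) := by
    refine ⟨affineToricMap k e', ?_, ?_⟩
    · rw [← affineToricMap_comp, ← affineToricMap_id]; congr 1
    · rw [← affineToricMap_comp, ← affineToricMap_id]; congr 1
  have h4 : affineToricMap k (AddSubmonoid.inclusion (le_top : Γ ≤ ⊤)) =
      affineToricMap k e ≫ affineToricMap k Γ.subtype := by
    rw [← affineToricMap_comp]; rfl
  have h5 : IsOpenImmersion (affineToricMap k (AddSubmonoid.inclusion (le_top : Γ ≤ ⊤))).left := by
    have h6 : IsIso (affineToricMap k e).left :=
      inferInstanceAs (IsIso ((Over.forget _).map (affineToricMap k e)))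
    rw [h4, Over.comp_left]; infer_instance
  exact closure_eq_top_of_isLoc_top (isLoc_of_isOpenImmersion (k := k) le_top hM.1)

/-- Both morphisms restrict to `t` on the dense torus, and `X` is separated. In particular a
semigroup has at most one chart. -/
theorem IsChart.inclusion_comp [IsSeparated X.hom] {Γ Γ' : AddSubmonoid M}
    {χ : affineToric k Γ ⟶ X} {χ' : affineToric k Γ' ⟶ X} (hχ : IsChart t Γ χ)
    (hχ' : IsChart t Γ' χ') (h : Γ ≤ Γ') :
    affineToricMap k (AddSubmonoid.inclusion h) ≫ χ = χ' := by
  ext1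
  have := isDominant_subtype (k := k) Γ'
  refine ext_of_isDominant_of_isSeparated X.hom ?_ (affineToricMap k Γ'.subtype).left ?_
  · rw [Over.w, Over.w]
  · rw [← Over.comp_left, ← Over.comp_left, ← Category.assoc, inclusion_comp_chart, hχ.fac,
      hχ'.fac]

/-- The intersection of two charts of a separated scheme is a chart. -/
theorem IsChart.sup [IsIntegral X.left] [IsSeparated X.hom] [LocallyOfFiniteType X.hom]
    {Γ Γ' : AddSubmonoid M} {χ : affineToric k Γ ⟶ X} {χ' : affineToric k Γ' ⟶ X}
    [IsOpenImmersion t.left] (hχ : IsChart t Γ χ) (hχ' : IsChart t Γ' χ') :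
    IsLoc Γ (Γ ⊔ Γ') ∧ ∃ χ'' : affineToric k (Γ ⊔ Γ' : AddSubmonoid M) ⟶ X,
      IsChart t (Γ ⊔ Γ') χ'' ∧ Set.range χ.left ∩ Set.range χ'.left ⊆ Set.range χ''.left := by
  have := hχ.isOpenImmersion
  have := hχ'.isOpenImmersion
  let P := pullback χ.left χ'.left
  let Q := affineToric k Γ ⊗ affineToric k Γ'
  let i : P ⟶ Q.left := pullback.lift (f := (affineToric k Γ).hom) (g := (affineToric k Γ').hom)
    (pullback.fst _ _) (pullback.snd _ _) (by
      rw [← Over.w χ, ← Over.w χ', pullback.condition_assoc])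
  have hi : IsClosedImmersion i :=
    isClosedImmersion_lift_of_isSeparated _ _ X.hom _ _ (Over.w χ) (Over.w χ') _
  let inl := AddSubmonoid.inclusion (le_sup_left : Γ ≤ Γ ⊔ Γ')
  let inr := AddSubmonoid.inclusion (le_sup_right : Γ' ≤ Γ ⊔ Γ')
  let s : affineToric k (Γ ⊔ Γ' : AddSubmonoid M) ⟶ Q :=
    CartesianMonoidalCategory.lift (affineToricMap k inl) (affineToricMap k inr)
  have hs : IsClosedImmersion s.left := isClosedImmersion_lift_inclusion Γ Γ'
  let a : (torus k M).left ⟶ P := pullback.lift (affineToricMap k Γ.subtype).left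
    (affineToricMap k Γ'.subtype).left (by
      rw [← Over.comp_left, ← Over.comp_left, hχ.fac, hχ'.fac])
  have : IsIntegral (torus k M).left :=
    inferInstanceAs (IsIntegral (Spec (.of (AddMonoidAlgebra k M))))
  have : Nonempty P := Nonempty.map a inferInstance
  have : IsIntegral P := isIntegral_of_isOpenImmersion (pullback.fst χ.left χ'.left)
  -- The torus is a nonempty open subset of the irreducible `P`.
  have ha : IsDominant a := by
    have h1 : a ≫ pullback.fst χ.left χ'.left = (affineToricMap k Γ.subtype).left :=
      pullback.lift_fst _ _ _
    have h2 : IsOpenImmersion (a ≫ pullback.fst χ.left χ'.left) := by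
      have : IsOpenImmersion ((affineToricMap k Γ.subtype).left ≫ χ.left) := by
        rw [← Over.comp_left, hχ.fac]; infer_instance
      rw [h1]
      exact IsOpenImmersion.of_comp _ χ.left
    have h3 : IsOpenImmersion a := IsOpenImmersion.of_comp _ (pullback.fst χ.left χ'.left)
    exact ⟨a.isOpenEmbedding.isOpen_range.dense (Set.range_nonempty a)⟩
  have := isDominant_subtype (k := k) (Γ ⊔ Γ')
  have hai : a ≫ i = (affineToricMap k (Γ ⊔ Γ').subtype).left ≫ s.left := by
    have h1 : (affineToricMap k (Γ ⊔ Γ').subtype ≫ s) ≫ CartesianMonoidalCategory.fst _ _ =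
        affineToricMap k Γ.subtype := by
      rw [Category.assoc, CartesianMonoidalCategory.lift_fst, inclusion_comp_chart]
    have h2 : (affineToricMap k (Γ ⊔ Γ').subtype ≫ s) ≫ CartesianMonoidalCategory.snd _ _ =
        affineToricMap k Γ'.subtype := by
      rw [Category.assoc, CartesianMonoidalCategory.lift_snd, inclusion_comp_chart]
    rw [← Over.comp_left]
    apply pullback.hom_ext
    · rw [Category.assoc, pullback.lift_fst, pullback.lift_fst]
      exact (congrArg CommaMorphism.left h1).symm
    · rw [Category.assoc, pullback.lift_snd, pullback.lift_snd]
      exact (congrArg CommaMorphism.left h2).symm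
  -- The intersection `P` and `T^{Γ + Γ'}` are integral closed subschemes of `T^Γ × T^{Γ'}` in which
  -- the same torus is dense, so they have the same ideal.
  have hker : i.ker = s.left.ker := by
    rw [← ker_comp_eq_of_isDominant a i, hai, ker_comp_eq_of_isDominant]
  let e := IsClosedImmersion.lift i s.left hker.le
  have he : IsIso e := IsClosedImmersion.isIso_lift i s.left hker
  have hei : e ≫ i = s.left := IsClosedImmersion.lift_fac ..
  have he1 : e ≫ pullback.fst χ.left χ'.left = (affineToricMap k inl).left := by
    have h1 : i ≫ pullback.fst (affineToric k Γ).hom (affineToric k Γ').hom =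
        pullback.fst χ.left χ'.left := pullback.lift_fst _ _ _
    rw [← h1, reassoc_of% hei]
    exact congrArg CommaMorphism.left
      (CartesianMonoidalCategory.lift_fst (affineToricMap k inl) (affineToricMap k inr))
  -- Under the identification with `P`, the map to `T^Γ` becomes the first projection, a base change
  -- of the open immersion `χ'`.
  have hop : IsOpenImmersion (affineToricMap k inl).left := by
    rw [← he1]; infer_instance
  have hχ'' : IsChart t (Γ ⊔ Γ') (affineToricMap k inl ≫ χ) :=
    { isOpenImmersion := by rw [Over.comp_left]; infer_instance
      fac := by rw [← Category.assoc, inclusion_comp_chart, hχ.fac] }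
  refine ⟨isLoc_of_isOpenImmersion (k := k) le_sup_left (hχ.fg.sup hχ'.fg), _, hχ'', ?_⟩
  rintro _ ⟨⟨x, rfl⟩, ⟨y, hy⟩⟩
  obtain ⟨z, hz, -⟩ := Scheme.Pullback.exists_preimage_pullback x y hy.symm
  obtain ⟨w, rfl⟩ := e.surjective z
  refine ⟨w, ?_⟩
  rw [Over.comp_left, Scheme.Hom.comp_apply, ← he1, Scheme.Hom.comp_apply, hz]

end Charts

/-! ### Invariant affine open subsets are equivariant charts. -/

section InvariantOpens

variable {k : Type u} [Field k]

/-- An open subset of a scheme with an action that is invariant and meets an open orbit contains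
the orbit. -/
theorem mem_of_invariant {G X : Over (Spec (.of k))} [GrpObj G] (t : G ⟶ X) (a : G ⊗ X ⟶ X)
    (ha : G ◁ t ≫ a = μ[G] ≫ t) (U : X.left.Opens)
    (hU : (pullback.snd G.hom X.hom : (G ⊗ X).left ⟶ X.left) ⁻¹ᵁ U ≤ a.left ⁻¹ᵁ U)
    {y : G.left} (hy : t.left y ∈ U) (x : G.left) : t.left x ∈ U := by
  -- On points `s` is `(g, h) ↦ (g h⁻¹, h)`, so that the product of the coordinates of `s (g, h)` is
  -- `g`.
  let s : G ⊗ G ⟶ G ⊗ G := CartesianMonoidalCategory.lift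
    (CartesianMonoidalCategory.fst G G / CartesianMonoidalCategory.snd G G)
    (CartesianMonoidalCategory.snd G G)
  have hs : s ≫ μ[G] = CartesianMonoidalCategory.fst G G := by
    rw [← Hom.mul_def, div_mul_cancel]
  have hs' : s ≫ CartesianMonoidalCategory.snd G G = CartesianMonoidalCategory.snd G G :=
    CartesianMonoidalCategory.lift_snd _ _
  -- The points `x` and `y` need not be rational; a point `z` of `G × G` above both takes the place
  -- of the pair. Then `s z` has second coordinate `y`, whose image lies in `U`, and acting gives `t
  -- x`.
  obtain ⟨z, hzx, hzy⟩ := Scheme.Pullback.exists_preimage_pullback (f := G.hom) (g := G.hom) x y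
    (Subsingleton.elim (α := PrimeSpectrum k) _ _)
  have h1 : (s ≫ G ◁ t ≫ CartesianMonoidalCategory.snd G X).left z = t.left y := by
    rw [CartesianMonoidalCategory.whiskerLeft_snd, reassoc_of% hs', Over.comp_left,
      Scheme.Hom.comp_apply, ← hzy]
    rfl
  have h2 : (s ≫ G ◁ t ≫ a).left z = t.left x := by
    rw [ha, reassoc_of% hs, Over.comp_left, Scheme.Hom.comp_apply, ← hzx]
    rfl
  have h3 : (s ≫ G ◁ t).left z ∈
      (pullback.snd G.hom X.hom : (G ⊗ X).left ⟶ X.left) ⁻¹ᵁ U := by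
    rw [← h1] at hy
    rw [← Category.assoc, Over.comp_left, Scheme.Hom.comp_apply] at hy
    exact hy
  rw [← h2, ← Category.assoc, Over.comp_left, Scheme.Hom.comp_apply]
  exact hU h3

/-- A morphism over `S` that maps into an open subscheme factors through it. -/
theorem exists_lift_of_isOpenImmersion {S : Scheme.{u}} {Y Z X : Over S} (u : Z ⟶ X)
    [IsOpenImmersion u.left] (f : Y ⟶ X) (h : ∀ y, f.left y ∈ Set.range u.left) :
    ∃ g : Y ⟶ Z, g ≫ u = f := by
  have h1 : Set.range f.left ⊆ Set.range u.left := by rintro _ ⟨y, rfl⟩; exact h y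
  refine ⟨Over.homMk (IsOpenImmersion.lift u.left f.left h1) ?_, ?_⟩
  · rw [← Over.w u, IsOpenImmersion.lift_fac_assoc, Over.w]
  · ext1
    exact IsOpenImmersion.lift_fac _ _ _

theorem hom_ext_of_isOpenImmersion {S : Scheme.{u}} {Y Z X : Over S} (u : Z ⟶ X)
    [IsOpenImmersion u.left] {f g : Y ⟶ Z} (h : f ≫ u = g ≫ u) : f = g := by
  ext1
  rw [← cancel_mono u.left, ← Over.comp_left, ← Over.comp_left, h]

variable {M : Type} [AddCommGroup M] {X : Over (Spec (.of k))} {t : torus k M ⟶ X}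
  {a : torus k M ⊗ X ⟶ X}

/-- An affine open subscheme that contains the torus and is invariant under the torus is a toric
chart. -/
theorem exists_isChart_of_specOver [IsIntegral X.left] [IsOpenImmersion t.left]
    (ha : torus k M ◁ t ≫ a = μ[torus k M] ≫ t) {A : Type u} [CommRing A] [Algebra k A]
    (v : specOver k A ⟶ X) [IsOpenImmersion v.left] (ht : ∀ y, t.left y ∈ Set.range v.left)
    (hv : ∀ z, (torus k M ◁ v ≫ a).left z ∈ Set.range v.left) :
    ∃ (Γ : AddSubmonoid M) (χ : affineToric k Γ ⟶ X),
      IsChart t Γ χ ∧ Set.range χ.left = Set.range v.left := by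
  obtain ⟨t', ht'⟩ := exists_lift_of_isOpenImmersion v t ht
  obtain ⟨a', ha'⟩ := exists_lift_of_isOpenImmersion v (torus k M ◁ v ≫ a) hv
  have hta : torus k M ◁ t' ≫ a' = μ[torus k M] ≫ t' := by
    apply hom_ext_of_isOpenImmersion v
    rw [Category.assoc, ha', ← MonoidalCategory.whiskerLeft_comp_assoc, ht', ha, Category.assoc,
      ht']
  obtain ⟨i, rfl⟩ := exists_specMap_eq t'
  obtain ⟨c, hc⟩ := exists_specMap_eq (specProd.hom ≫ a')
  -- Compatibility of the restricted action with multiplication on the torus, read in coordinate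
  -- rings, is the comodule condition.
  have hic : (Algebra.TensorProduct.map (AlgHom.id k (AddMonoidAlgebra k M)) i).comp c =
      (Bialgebra.comulAlgHom k (AddMonoidAlgebra k M)).comp i := by
    apply specMap_injective
    rw [specMap_comp, specMap_comp, hc, ← specProd_mul, ← Category.assoc, specProd_whiskerLeft,
      Category.assoc, Category.assoc, hta]
  have : Nonempty (specOver k A).left := Nonempty.map (specMap i).left (by
    show Nonempty (PrimeSpectrum (AddMonoidAlgebra k M)); infer_instance)
  have hA : IsIntegral (specOver k A).left := isIntegral_of_isOpenImmersion v.left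
  -- The torus is dense in the integral scheme `Spec A`, so the kernel of `i` is nilpotent and hence
  -- zero.
  have hinj : Function.Injective i := by
    have h1 : IsOpenImmersion ((specMap i).left ≫ v.left) := by
      rw [← Over.comp_left, ht']; infer_instance
    have h2 : IsOpenImmersion (specMap i).left := IsOpenImmersion.of_comp _ v.left
    have : Nonempty (torus k M).left := by
      show Nonempty (PrimeSpectrum (AddMonoidAlgebra k M)); infer_instance
    have h3 : DenseRange (specMap i).left :=
      (specMap i).left.isOpenEmbedding.isOpen_range.dense (Set.range_nonempty _)
    have h4 := (PrimeSpectrum.denseRange_comap_iff_ker_le_nilRadical i.toRingHom).1 h3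
    have : IsDomain A := (affine_isIntegral_iff (.of A)).1 hA
    rw [nilradical_eq_zero, Submodule.zero_eq_bot, le_bot_iff] at h4
    exact (RingHom.injective_iff_ker_eq_bot i.toRingHom).2 h4
  obtain ⟨e, he⟩ := exists_algEquiv_of_comodule i hinj c hic
  have : IsIso (specMap e.toAlgHom).left :=
    inferInstanceAs (IsIso ((Over.forget _).map (specMap e.toAlgHom)))
  refine ⟨_, specMap e.toAlgHom ≫ v, ⟨?_, ?_⟩, ?_⟩
  · rw [Over.comp_left]; infer_instance
  · rw [affineToricMap_eq_specMap, ← Category.assoc, ← specMap_comp, he, ht']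
  · ext x
    constructor
    · rintro ⟨y, rfl⟩
      exact ⟨(specMap e.toAlgHom).left y, by rw [Over.comp_left, Scheme.Hom.comp_apply]⟩
    · rintro ⟨y, rfl⟩
      obtain ⟨y, rfl⟩ := (specMap e.toAlgHom).left.surjective y
      exact ⟨y, by rw [Over.comp_left, Scheme.Hom.comp_apply]⟩

/-- As `X` is irreducible, a nonempty open `U` meets the torus, and by invariance it contains all of
it. -/
theorem exists_isChart_of_isAffineOpen [IsIntegral X.left] [IsOpenImmersion t.left]
    (ha : torus k M ◁ t ≫ a = μ[torus k M] ≫ t) {U : X.left.Opens} (hU : IsAffineOpen U)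
    (hne : (U : Set X.left).Nonempty)
    (hinv : (pullback.snd (torus k M).hom X.hom : (torus k M ⊗ X).left ⟶ X.left) ⁻¹ᵁ U ≤
      a.left ⁻¹ᵁ U) :
    ∃ (Γ : AddSubmonoid M) (χ : affineToric k Γ ⟶ X),
      IsChart t Γ χ ∧ Set.range χ.left = (U : Set X.left) := by
  have : Nonempty (torus k M).left := by
    show Nonempty (PrimeSpectrum (AddMonoidAlgebra k M)); infer_instance
  obtain ⟨_, hyU, y, rfl⟩ := nonempty_preirreducible_inter U.2 t.left.isOpenEmbedding.isOpen_range
    hne (Set.range_nonempty _)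
  let φ : CommRingCat.of k ⟶ Γ(X.left, U) := Spec.preimage (hU.fromSpec ≫ X.hom)
  let _ : Algebra k Γ(X.left, U) := φ.hom.toAlgebra
  let v : specOver k Γ(X.left, U) ⟶ X := Over.homMk hU.fromSpec (Spec.map_preimage _).symm
  have hv : IsOpenImmersion v.left := inferInstanceAs (IsOpenImmersion hU.fromSpec)
  have hr : Set.range v.left = (U : Set X.left) := hU.range_fromSpec
  obtain ⟨Γ, χ, hχ, h⟩ := exists_isChart_of_specOver ha v
    (fun x => by rw [hr]; exact mem_of_invariant t a ha U hinv hyU x) (fun z => by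
      rw [hr, Over.comp_left, Scheme.Hom.comp_apply]
      apply hinv
      have h1 : (torus k M ◁ v ≫ CartesianMonoidalCategory.snd _ _).left z ∈ U := by
        rw [CartesianMonoidalCategory.whiskerLeft_snd, Over.comp_left, Scheme.Hom.comp_apply]
        exact hr.subset ⟨_, rfl⟩
      rw [Over.comp_left, Scheme.Hom.comp_apply] at h1
      exact h1)
  exact ⟨Γ, χ, hχ, h.trans hr⟩

theorem injective_map_id_subtype (Γ : AddSubmonoid M) :
    Function.Injective (Algebra.TensorProduct.map (AlgHom.id k (AddMonoidAlgebra k M))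
      (AddMonoidAlgebra.mapDomainAlgHom k k Γ.subtype)) :=
  Module.Flat.lTensor_preserves_injective_linearMap (M := AddMonoidAlgebra k M)
    (AddMonoidAlgebra.mapDomainAlgHom k k Γ.subtype).toLinearMap
    (AddMonoidAlgebra.mapDomain_injective Subtype.val_injective)

/-- Charts are equivariant. -/
theorem IsChart.equivariant [UniqueSums M] [IsSeparated X.hom]
    (ha : torus k M ◁ t ≫ a = μ[torus k M] ≫ t) {Γ : AddSubmonoid M} {χ : affineToric k Γ ⟶ X}
    (hχ : IsChart t Γ χ) : torus k M ◁ χ ≫ a = affineAction k Γ ≫ χ := by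
  -- Both sides restrict to `μ` followed by `t` on the product of the torus with itself. This
  -- product is dense in the reduced scheme `T^M × T^Γ`, and `X` is separated.
  have h1 : torus k M ◁ affineToricMap k Γ.subtype ≫ affineAction k Γ =
      μ[torus k M] ≫ affineToricMap k Γ.subtype := by
    rw [← cancel_epi specProd.hom, affineToricMap_eq_specMap, ← Category.assoc,
      ← specProd_whiskerLeft, Category.assoc, specProd_affineAction, ← Category.assoc specProd.hom,
      specProd_mul, ← specMap_comp, ← specMap_comp]
    congr 1
    ext g
    simp [coaction_single]
  have h2 : torus k M ◁ affineToricMap k Γ.subtype ≫ torus k M ◁ χ ≫ a =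
      torus k M ◁ affineToricMap k Γ.subtype ≫ affineAction k Γ ≫ χ := by
    rw [← MonoidalCategory.whiskerLeft_comp_assoc, hχ.fac, ha, reassoc_of% h1, hχ.fac]
  rw [← cancel_epi specProd.hom]
  have h3 : specMap (Algebra.TensorProduct.map (AlgHom.id k (AddMonoidAlgebra k M))
      (AddMonoidAlgebra.mapDomainAlgHom k k Γ.subtype)) ≫ specProd.hom ≫ torus k M ◁ χ ≫ a =
      specMap (Algebra.TensorProduct.map (AlgHom.id k (AddMonoidAlgebra k M))
      (AddMonoidAlgebra.mapDomainAlgHom k k Γ.subtype)) ≫ specProd.hom ≫ affineAction k Γ ≫ χ := by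
    rw [reassoc_of% specProd_whiskerLeft, reassoc_of% specProd_whiskerLeft,
      ← affineToricMap_eq_specMap, h2]
  have hinj := injective_map_id_subtype (k := k) Γ
  have h4 := isDominant_specMap _ hinj
  -- A tensor product of domains need not be a domain. Here `k[M] ⊗ k[M]` is the group algebra of
  -- `M` over the domain `k[M]`, and unique sums in `M` exclude zero divisors.
  let e : AddMonoidAlgebra k M ⊗[k] AddMonoidAlgebra k M ≃ₐ[AddMonoidAlgebra k M]
      AddMonoidAlgebra (AddMonoidAlgebra k M) M := AddMonoidAlgebra.scalarTensorEquiv ..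
  have : IsDomain (AddMonoidAlgebra k M ⊗[k] AddMonoidAlgebra k M) :=
    Function.Injective.isDomain e e.injective
  have : IsDomain (AddMonoidAlgebra k M ⊗[k] AddMonoidAlgebra k Γ) :=
    Function.Injective.isDomain _ hinj
  have : IsReduced (specOver k (AddMonoidAlgebra k M ⊗[k] AddMonoidAlgebra k Γ)).left :=
    inferInstanceAs (IsReduced (Spec (.of (AddMonoidAlgebra k M ⊗[k] AddMonoidAlgebra k Γ))))
  ext1
  refine ext_of_isDominant_of_isSeparated X.hom ?_ _ (congrArg CommaMorphism.left h3)
  rw [Over.w, Over.w]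

end InvariantOpens

/-! ### Comparing `X` with the glued toric variety. -/

section Main

variable {k : Type u} [Field k]

/-- The image of the unit is idempotent in the group of points `𝟙_ 𝒞 ⟶ H`, hence trivial. -/
theorem isMonHom_of_mul_hom {𝒞 : Type*} [Category* 𝒞] [CartesianMonoidalCategory 𝒞] {G H : 𝒞}
    [GrpObj G] [GrpObj H] (f : G ⟶ H) (h : μ[G] ≫ f = (f ⊗ₘ f) ≫ μ[H]) : IsMonHom f where
  one_hom := by
    have h1 : (η[G] ≫ f) * (η[G] ≫ f) = η[G] ≫ f := by
      rw [Hom.mul_def, ← CartesianMonoidalCategory.lift_map_assoc, ← h, ← Category.assoc,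
        ← Hom.mul_def]
      congr 1
      have : (1 : 𝟙_ 𝒞 ⟶ G) = η[G] := by
        rw [Hom.one_def, CartesianMonoidalCategory.toUnit_unique
          (CartesianMonoidalCategory.toUnit (𝟙_ 𝒞)) (𝟙 _), Category.id_comp]
      rw [← this, mul_one]
    have h2 : η[G] ≫ f = 1 := by simpa using h1
    rw [h2, Hom.one_def, CartesianMonoidalCategory.toUnit_unique
      (CartesianMonoidalCategory.toUnit (𝟙_ 𝒞)) (𝟙 _), Category.id_comp]
  mul_hom := h

theorem isMonHom_affineToricMap {G H : Type} [AddCommGroup G] [AddCommGroup H] (f : G →+ H) :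
    IsMonHom (affineToricMap k f : torus k H ⟶ torus k G) := by
  apply isMonHom_of_mul_hom
  rw [← cancel_epi specProd.hom, affineToricMap_eq_specMap, ← Category.assoc, specProd_mul,
    ← Category.assoc specProd.hom, ← specProd_map, Category.assoc, specProd_mul, ← specMap_comp,
    ← specMap_comp]
  congr 1
  ext g
  simp

/-- The torus of a lattice depends only on the lattice up to isomorphism. -/
theorem exists_torus_iso {G H : Type} [AddCommGroup G] [AddCommGroup H] (f : G ≃+ H) :
    ∃ φ : torus k H ≅ torus k G, IsMonHom φ.hom := by
  refine ⟨⟨affineToricMap k f.toAddMonoidHom, affineToricMap k f.symm.toAddMonoidHom, ?_, ?_⟩,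
    isMonHom_affineToricMap _⟩
  · rw [← affineToricMap_comp, ← affineToricMap_id]; congr 1; ext x; simp
  · rw [← affineToricMap_comp, ← affineToricMap_id]; congr 1; ext x; simp

variable {N : Type} [AddCommGroup N] {X : Over (Spec (.of k))} [IsSeparated X.hom]
  {t : torus k (Module.Dual ℤ N) ⟶ X} [IsDomain (AddMonoidAlgebra k (Module.Dual ℤ N))]

theorem IsChart.range_subset {Γ Γ' : AddSubmonoid (Module.Dual ℤ N)} {χ : affineToric k Γ ⟶ X}
    {χ' : affineToric k Γ' ⟶ X} (hχ : IsChart t Γ χ) (hχ' : IsChart t Γ' χ') (h : Γ ≤ Γ') :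
    Set.range χ'.left ⊆ Set.range χ.left := by
  rw [← hχ.inclusion_comp hχ' h]
  rintro _ ⟨x, rfl⟩
  exact ⟨_, (Scheme.Hom.comp_apply _ _ _).symm⟩

/-- A scheme that is covered by charts `T^{Γ_σ}` for the cones of a fan, with the intersections
covered by charts of smaller cones, is the toric variety. -/
theorem exists_iso_toricVariety (D : ToricData N) (χ : ∀ σ, affineToric k (D.Γ σ) ⟶ X)
    (hχ : ∀ σ, IsChart t (D.Γ σ) (χ σ)) (hcov : ∀ x, ∃ σ, x ∈ Set.range (χ σ).left)
    (hdir : ∀ σ τ x, x ∈ Set.range (χ σ).left → x ∈ Set.range (χ τ).left →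
      ∃ ρ, ρ ≤ σ ∧ ρ ≤ τ ∧ x ∈ Set.range (χ ρ).left) :
    ∃ ψ : X ≅ D.toricVariety k, ∀ σ, D.chart k σ ≫ ψ.inv = χ σ := by
  have hop := fun σ => (hχ σ).isOpenImmersion
  have hw : ∀ {τ σ : D.Cone} (g : τ ⟶ σ), (D.schemeDiagram k).map g ≫ (χ σ).left = (χ τ).left :=
    fun g => congrArg CommaMorphism.left
      ((hχ _).inclusion_comp (hχ _) (D.Γ_le (leOfHom g)))
  -- The overlap of two charts in `X` is covered by charts of smaller cones. This lets morphisms out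
  -- of `X` be glued by checking agreement only along inclusions of cones.
  have hlift : ∀ (σ τ : D.Cone) (z : (pullback (χ σ).left (χ τ).left : Scheme)),
      ∃ (ρ : D.Cone) (g : ρ ⟶ σ) (g' : ρ ⟶ τ) (y : (D.schemeDiagram k).obj ρ),
        pullback.lift (f := (χ σ).left) (g := (χ τ).left) ((D.schemeDiagram k).map g)
          ((D.schemeDiagram k).map g') ((hw g).trans (hw g').symm) y = z := by
    intro σ τ z
    have := hop σ
    have := hop τ
    let p := pullback.fst (χ σ).left (χ τ).left
    let q := pullback.snd (χ σ).left (χ τ).left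
    obtain ⟨ρ, hρσ, hρτ, y, hy⟩ := hdir σ τ ((χ σ).left (p z)) ⟨_, rfl⟩ ⟨q z, by
      rw [← Scheme.Hom.comp_apply, ← Scheme.Hom.comp_apply, pullback.condition]⟩
    refine ⟨ρ, homOfLE hρσ, homOfLE hρτ, y, ?_⟩
    apply p.isOpenEmbedding.injective
    apply (χ σ).left.isOpenEmbedding.injective
    have h1 := pullback.lift_fst (f := (χ σ).left) (g := (χ τ).left)
      ((D.schemeDiagram k).map (homOfLE hρσ)) ((D.schemeDiagram k).map (homOfLE hρτ))
      ((hw (homOfLE hρσ)).trans (hw (homOfLE hρτ)).symm)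
    have h2 := congrArg (fun f : (D.schemeDiagram k).obj ρ ⟶ (affineToric k (D.Γ σ)).left =>
      (χ σ).left (f y)) h1
    exact h2.trans ((congrArg (fun f : (D.schemeDiagram k).obj ρ ⟶ X.left => f y)
      (hw (homOfLE hρσ))).trans hy)
  let 𝒱 : X.left.OpenCover :=
    { I₀ := D.Cone
      X := fun σ => (affineToric k (D.Γ σ)).left
      f := fun σ => (χ σ).left
      mem₀ := by
        rw [Scheme.presieve₀_mem_precoverage_iff]
        exact ⟨fun x => hcov x, fun σ => hop σ⟩ }
  let _ : Category 𝒱.I₀ := inferInstanceAs (Category D.Cone)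
  let _ : Scheme.Cover.LocallyDirected 𝒱 :=
    { trans := fun g => (D.schemeDiagram k).map g
      trans_id := fun σ => (D.schemeDiagram k).map_id σ
      trans_comp := fun f g => (D.schemeDiagram k).map_comp f g
      w := fun g => hw g
      directed := fun {σ τ} z => hlift σ τ z
      property_trans := fun g => D.isOpenImmersion_map k g }
  let f : X.left ⟶ (D.toricVariety k).left := 𝒱.glueMorphismsOfLocallyDirected
    (fun σ => (D.chart k σ).left) (fun g => colimit.w (D.schemeDiagram k) g)
  have hf : ∀ σ, (χ σ).left ≫ f = (D.chart k σ).left := fun σ =>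
    𝒱.map_glueMorphismsOfLocallyDirected _ (fun g => colimit.w (D.schemeDiagram k) g) σ
  -- The inverse comes from the universal property of the colimit; both composites are identities
  -- because they are so on every chart.
  let g : (D.toricVariety k).left ⟶ X.left :=
    colimit.desc (D.schemeDiagram k) ⟨X.left, ⟨fun σ => (χ σ).left,
      fun _ _ g => (hw g).trans (Category.comp_id _).symm⟩⟩
  have hg : ∀ σ, (D.chart k σ).left ≫ g = (χ σ).left := fun σ => colimit.ι_desc _ _
  have hfg : f ≫ g = 𝟙 _ := 𝒱.hom_ext _ _ fun σ => by
    have : (χ σ).left ≫ f ≫ g = (χ σ).left ≫ 𝟙 _ := by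
      rw [← Category.assoc, hf, hg, Category.comp_id]
    exact this
  have hgf : g ≫ f = 𝟙 _ := (D.cover k).hom_ext _ _ fun (σ : D.Cone) => by
    have : (D.chart k σ).left ≫ g ≫ f = (D.chart k σ).left ≫ 𝟙 _ := by
      rw [← Category.assoc, hg, hf, Category.comp_id]
    exact this
  have hw' : f ≫ (D.toricVariety k).hom = X.hom := 𝒱.hom_ext _ _ fun σ => by
    have : (χ σ).left ≫ f ≫ (D.toricVariety k).hom = (χ σ).left ≫ X.hom := by
      rw [← Category.assoc, hf, Over.w, Over.w]
    exact this
  refine ⟨Over.isoMk ⟨f, g, hfg, hgf⟩ hw', fun σ => ?_⟩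
  ext1
  exact hg σ

end Main

/-! ### The fan of a variety with a split torus, and the theorem. -/

section Main

variable {k : Type u} [Field k]

/-- Evaluation embeds the dual in a power of `ℤ`. Unique sums make the group algebra of `M` over any
domain a domain. -/
theorem uniqueSums_dual (N : Type) [AddCommGroup N] : UniqueSums (Module.Dual ℤ N) :=
  let f : Module.Dual ℤ N →ₙ+ (N → ℤ) := ⟨fun m => m, fun _ _ => rfl⟩
  UniqueSums.of_injective_addHom f (fun _ _ h => DFunLike.coe_injective h) inferInstance

theorem ToricData.toProd_whiskerLeft {N : Type} [AddCommGroup N] (D : ToricData N) (σ : D.Cone) :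
    D.toProd k σ ≫ (torus k (Module.Dual ℤ N) ◁ D.chart k σ).left =
      pullback.fst (pullback.snd (torus k (Module.Dual ℤ N)).hom (D.toricVariety k).hom)
        (D.chart k σ).left := by
  apply pullback.hom_ext
  · rw [Category.assoc, Over.whiskerLeft_left_fst, D.toProd_fst k σ]
  · rw [Category.assoc, Over.whiskerLeft_left_snd, reassoc_of% D.toProd_snd k σ,
      pullback.condition]

/-- A morphism out of `T × T_Σ^Γ` is determined by its restrictions to the charts. -/
theorem ToricData.hom_ext_of_chart {N : Type} [AddCommGroup N] (D : ToricData N)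
    {X : Over (Spec (.of k))} {f g : torus k (Module.Dual ℤ N) ⊗ D.toricVariety k ⟶ X}
    (h : ∀ σ, torus k (Module.Dual ℤ N) ◁ D.chart k σ ≫ f =
      torus k (Module.Dual ℤ N) ◁ D.chart k σ ≫ g) : f = g := by
  ext1
  refine (D.actionCover k).hom_ext _ _ fun (σ : D.Cone) => ?_
  change pullback.fst (pullback.snd (torus k (Module.Dual ℤ N)).hom (D.toricVariety k).hom)
    (D.chart k σ).left ≫ _ = pullback.fst _ (D.chart k σ).left ≫ _
  rw [← D.toProd_whiskerLeft, Category.assoc, Category.assoc, ← Over.comp_left, ← Over.comp_left,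
    h σ]

variable {N : Type} [AddCommGroup N] [Module.Free ℤ N] [Module.Finite ℤ N]
  {X : Over (Spec (.of k))} [IsIntegral X.left] [IsSeparated X.hom] [LocallyOfFiniteType X.hom]
  {t : torus k (Module.Dual ℤ N) ⟶ X} [IsOpenImmersion t.left]
  {a : torus k (Module.Dual ℤ N) ⊗ X ⟶ X}

/-- A separated variety with an action of a split torus that extends the multiplication of a dense
open torus is a toric variety `T_Σ^Γ` if it is covered by invariant affine open subsets. -/
theorem exists_iso_toricVariety_of_cover (ha : torus k (Module.Dual ℤ N) ◁ t ≫ a = μ ≫ t)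
    {𝒰 : Set X.left.Opens} (h𝒰 : 𝒰.Finite) (haff : ∀ U ∈ 𝒰, IsAffineOpen U)
    (hinv : ∀ U ∈ 𝒰, (pullback.snd (torus k (Module.Dual ℤ N)).hom X.hom :
      (torus k (Module.Dual ℤ N) ⊗ X).left ⟶ X.left) ⁻¹ᵁ U ≤ a.left ⁻¹ᵁ U) (hcov : sSup 𝒰 = ⊤) :
    ∃ (D : ToricData N) (ψ : X ≅ D.toricVariety k),
      torus k (Module.Dual ℤ N) ◁ ψ.inv ≫ a = D.action k ≫ ψ.inv ∧
      ∀ σ, t ≫ ψ.hom = affineToricMap k (D.Γ σ).subtype ≫ D.chart k σ := by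
  have := uniqueSums_dual N
  have : IsDomain (AddMonoidAlgebra k (Module.Dual ℤ N)) := inferInstance
  have hM : AddMonoid.FG (Module.Dual ℤ N) :=
    AddGroup.fg_iff_addMonoid_fg.1 (Module.Finite.iff_addGroup_fg.1 inferInstance)
  -- An empty member of the cover is affine and invariant but does not contain the torus, so it
  -- gives no chart.
  let 𝒱 := {U // U ∈ 𝒰 ∧ (U : Set X.left).Nonempty}
  have : Finite 𝒱 := (h𝒰.subset fun _ h => h.1 : {U | U ∈ 𝒰 ∧ (U : Set X.left).Nonempty}.Finite)
  choose G χ₀ hχ₀ hχ₀U using fun U : 𝒱 =>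
    exists_isChart_of_isAffineOpen ha (haff U.1 U.2.1) U.2.2 (hinv U.1 U.2.1)
  have h𝒢 := isFanFamily_setOf_isLoc (𝒢 := Set.range G) (Set.finite_range G)
    (by rintro _ ⟨U, rfl⟩; exact (hχ₀ U).fg)
    (by rintro _ ⟨U, rfl⟩; exact (hχ₀ U).closure_eq_top hM)
    (by rintro _ ⟨U, rfl⟩ _ ⟨V, rfl⟩; exact ((hχ₀ U).sup (hχ₀ V)).1)
  obtain ⟨D, hD, hD', hDσ⟩ := h𝒢.exists_toricData
  have hchart : ∀ σ, ∃ χ : affineToric k (D.Γ σ) ⟶ X, IsChart t (D.Γ σ) χ := fun σ => by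
    obtain ⟨_, ⟨U, rfl⟩, hU⟩ := hD σ
    exact ⟨_, (hχ₀ U).of_isLoc hU⟩
  choose χ hχ using hchart
  -- The order of the cones is recovered from the semigroups, because `σ` is the cone of `Γ_σ`.
  have hle : ∀ σ τ, D.Γ σ ≤ D.Γ τ → τ ≤ σ := fun σ τ h => by
    show τ.1 ≤ σ.1
    rw [← hDσ, ← hDσ]
    exact coneOf_anti h
  obtain ⟨ψ, hψ⟩ := exists_iso_toricVariety D χ hχ (fun x => by
    have hx : x ∈ sSup 𝒰 := hcov ▸ trivial
    obtain ⟨U, hU, hxU⟩ := TopologicalSpace.Opens.mem_sSup.1 hx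
    let V : 𝒱 := ⟨U, hU, x, hxU⟩
    obtain ⟨σ, hσ⟩ := hD' (G V) ⟨_, ⟨V, rfl⟩, IsLoc.refl _⟩
    exact ⟨σ, (hχ σ).range_subset (hχ₀ V) hσ.le ((hχ₀U V).symm ▸ hxU)⟩) (fun σ τ x hσ hτ => by
    -- A common point of two charts lies in the chart of `Γ_σ + Γ_τ`, which is the semigroup of a
    -- cone contained in both.
    obtain ⟨-, χ', hχ', hsub⟩ := (hχ σ).sup (hχ τ)
    obtain ⟨ρ, hρ⟩ := hD' _ (h𝒢.sup_mem (hD σ) (hD τ))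
    exact ⟨ρ, hle _ _ (le_sup_left.trans hρ.ge), hle _ _ (le_sup_right.trans hρ.ge),
      (hχ ρ).range_subset hχ' hρ.le (hsub ⟨hσ, hτ⟩)⟩)
  refine ⟨D, ψ, D.hom_ext_of_chart fun σ => ?_, fun σ => ?_⟩
  · rw [← MonoidalCategory.whiskerLeft_comp_assoc, hψ, (hχ σ).equivariant ha,
      reassoc_of% D.chart_action k σ, hψ]
  · rw [← (hχ σ).fac, ← hψ σ, Category.assoc, Category.assoc, Iso.inv_hom_id, Category.comp_id]

end Main

end Toric

theorem mainTheorem5 {k : Type u} [Field k] (T X : Over (Spec (.of k)))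
    [GrpObj T] [ModObj T X] (j : T ⟶ X) (hX : Toric.IsToricVariety T X j) :
    ∃ (N : Type) (_ : AddCommGroup N) (_ : Module.Free ℤ N) (_ : Module.Finite ℤ N)
      (D : Toric.ToricData N)
      (φ : T ≅ Toric.torus k (Module.Dual ℤ N)) (ψ : X ≅ D.toricVariety k),
      IsMonHom φ.hom ∧
      (γ[T, X] : T ⊗ X ⟶ X) ≫ ψ.hom = (φ.hom ⊗ₘ ψ.hom) ≫ D.action k ∧
      ∀ σ : D.Cone, j ≫ ψ.hom =
        φ.hom ≫ Toric.affineToricMap k (D.Γ σ).subtype ≫ D.chart k σ := by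
  obtain ⟨d, e, he⟩ := hX.isAlgebraicTorus
  -- With `N = ℤ^d`, the standard basis identifies the character lattice `ℤ^d` of the torus with the
  -- dual `M` of `N`.
  obtain ⟨e', he'⟩ := Toric.exists_torus_iso (k := k)
    (Pi.basisFun ℤ (Fin d)).toDualEquiv.symm.toAddEquiv
  have := hX.isIntegral
  have := hX.isSeparated
  have := hX.locallyOfFiniteType
  have := hX.isOpenImmersion
  obtain ⟨𝒰, h𝒰, h𝒰', hcov⟩ := hX.exists_cover
  let φ : T ≅ Toric.torus k (Module.Dual ℤ (Fin d → ℤ)) := e ≪≫ e'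
  have hφ : IsMonHom φ.hom := inferInstanceAs (IsMonHom (e.hom ≫ e'.hom))
  have : IsIso φ.inv.left := inferInstanceAs (IsIso ((Over.forget _).map φ.inv))
  have : IsOpenImmersion (φ.inv ≫ j).left := by
    rw [Over.comp_left]; infer_instance
  -- The embedding and the action of `T` are transported along `φ` to the split torus `T^M`. The
  -- transported action extends multiplication because `φ.inv` is a homomorphism, and the invariant
  -- open sets stay invariant.
  obtain ⟨D, ψ, h1, h2⟩ := Toric.exists_iso_toricVariety_of_cover (t := φ.inv ≫ j)
    (a := φ.inv ▷ X ≫ γ[T, X]) (by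
      rw [MonoidalCategory.whiskerLeft_comp, Category.assoc, whisker_exchange_assoc, hX.extends_mul,
        ← MonoidalCategory.tensorHom_def'_assoc, ← Category.assoc, ← IsMonHom.mul_hom,
        Category.assoc]) h𝒰 (fun U hU => (h𝒰' U hU).1) (fun U hU x hx => by
      have hw : (φ.inv ▷ X).left ≫ pullback.snd T.hom X.hom = pullback.snd _ _ :=
        Over.whiskerRight_left_snd _
      refine (h𝒰' U hU).2 (x := (φ.inv ▷ X).left x) ?_
      show ((φ.inv ▷ X).left ≫ pullback.snd T.hom X.hom) x ∈ U
      rw [hw]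
      exact hx) hcov
  refine ⟨Fin d → ℤ, inferInstance, inferInstance, inferInstance, D, φ, ψ, hφ, ?_, fun σ => ?_⟩
  · rw [← cancel_mono ψ.inv, Category.assoc, Category.assoc, Iso.hom_inv_id, Category.comp_id, ← h1,
      MonoidalCategory.tensorHom_def_assoc, ← MonoidalCategory.whiskerLeft_comp_assoc,
      Iso.hom_inv_id, MonoidalCategory.whiskerLeft_id, Category.id_comp,
      ← MonoidalCategory.comp_whiskerRight_assoc, Iso.hom_inv_id, MonoidalCategory.id_whiskerRight,
      Category.id_comp]
  · rw [← h2, Category.assoc, Iso.hom_inv_id_assoc]
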